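/- Let $d\ge 1$ and let $\mathscr L$ be a finite or countable set of (affine) lines in $\mathbb R^d$. For $\ell\in\mathscr L$ let $\pi_\ell$ be the orthogonal projection of $\mathbb R^d$ onto $\ell$, let $\dim$ denote Hausdorff dimension and $\mathcal H^s$ the $s$-dimensional Hausdorff measure. For $s\ge 0$ the $s$-capacity of a set $A\subseteq\mathbb R^d$ is $C_s(A)=\sup_\mu \left(\iint |x-y|^{-s}\,d\mu(y)\,d\mu(x)\right)^{-1}$, the supremum being over all Borel probability measures $\mu$ with compact support contained in $A$ (for $s=0$ the kernel is identically $1$). Then for every $t\in[0,1]$ there exists a compact set $\Gamma\subseteq[0,1]^d$ with $\dim\Gamma=d-1+t$ such that for every $\ell\in\mathscr L$ the projection $\pi_\ell$ is injective on $\Gamma$ and $\dim\pi_\ell(\Gamma)=t$. Furthermore, consider the following statements: 1. $C_{d-1+t}(\Gamma)>0$ and $\mathcal H^{d-1+t}(\Gamma)=\infty$. 2. $\mathcal H^{t}(\pi_\ell(\Gamma))=0$ for every $\ell\in\mathscr L$. If $0\le t<1$, then $\Gamma$ can be chosen, with all the properties above, so that (1) also holds; if $0<t\le 1$, then $\Gamma$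 can be chosen, with all the properties above, so that (2) also holds. (So for $t=0$ one can guarantee (1), for $t=1$ one can guarantee (2), and for $t\in(0,1)$ one can choose either of the two.) -/

import Mathlib

open MeasureTheory Set

noncomputable section

/-- A (straight, affine) line in `ℝ^d`: a nonempty affine subspace of dimension one. -/
abbrev EuclLine (d : ℕ) : Type :=
  {ℓ : AffineSubspace ℝ (EuclideanSpace ℝ (Fin d)) //
    (ℓ : Set (EuclideanSpace ℝ (Fin d))).Nonempty ∧ Module.finrank ℝ ℓ.direction = 1}

instance EuclLine.instNonempty {d : ℕ} (ℓ : EuclLine d) : Nonempty ℓ.1 :=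
  ℓ.2.1.to_subtype

/-- The orthogonal projection `π_ℓ` of `ℝ^d` onto the line `ℓ`, with values in `ℝ^d`. -/
def EuclLine.proj {d : ℕ} (ℓ : EuclLine d) (x : EuclideanSpace ℝ (Fin d)) :
    EuclideanSpace ℝ (Fin d) :=
  (EuclideanGeometry.orthogonalProjection ℓ.1 x : EuclideanSpace ℝ (Fin d))

/-- The unit cube `[0,1]^d`. -/
def euclUnitCube (d : ℕ) : Set (EuclideanSpace ℝ (Fin d)) :=
  {x | ∀ i, x i ∈ Icc (0 : ℝ) 1}

/-- The `s`-energy `I_s(μ) = ∬ |x - y|^{-s} dμ(y) dμ(x)`. In `ℝ≥0∞` the kernel takes the value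
`∞` on the diagonal if `s > 0`, and it is constantly `1` if `s = 0`. -/
def rieszEnergy {d : ℕ} (s : ℝ) (μ : Measure (EuclideanSpace ℝ (Fin d))) : ENNReal :=
  ∫⁻ x, ∫⁻ y, (edist x y) ^ (-s) ∂μ ∂μ

/-- The `s`-capacity `C_s(A)`: the supremum of `1 / I_s(μ)` over all Borel probability measures
`μ` concentrated on a compact subset of `A` (it is `0` if there are none). -/
def rieszCapacity {d : ℕ} (s : ℝ) (A : Set (EuclideanSpace ℝ (Fin d))) : ENNReal :=
  ⨆ (μ : Measure (EuclideanSpace ℝ (Fin d))) (_ : IsProbabilityMeasure μ)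
    (_ : ∃ K : Set (EuclideanSpace ℝ (Fin d)), K ⊆ A ∧ IsCompact K ∧ μ Kᶜ = 0),
    (rieszEnergy s μ)⁻¹

/-- `Γ` is a compact subset of `[0,1]^d` of Hausdorff dimension `d - 1 + t` whose orthogonal
projection to each line in `L` is injective on `Γ` and has image of Hausdorff dimension `t`. -/
structure LargeWithSmallInjectiveProjections {d : ℕ} (L : Set (EuclLine d)) (t : ℝ)
    (Γ : Set (EuclideanSpace ℝ (Fin d))) : Prop where
  isCompact : IsCompact Γ
  subset_cube : Γ ⊆ euclUnitCube d
  dimH_eq : dimH Γ = ENNReal.ofReal ((d : ℝ) - 1 + t)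
  injOn_proj : ∀ ℓ ∈ L, InjOn ℓ.proj Γ
  dimH_proj_eq : ∀ ℓ ∈ L, dimH (ℓ.proj '' Γ) = ENNReal.ofReal t

end

open Filter Topology Metric
open scoped ENNReal NNReal RealInnerProductSpace

/-! Start from a continuous density on the cube and multiply it successively by normalized bumps
`periodicBump η ⟪x, v⟫` with `η = ‖v‖ ^ (1 - 1 / α)`. Each step confines the support to slabs at
spacing `1 / ‖v‖` and of width about `‖v‖ ^ (-1 / α)`. The set `Γ` is the intersection of the
supports and carries a weak cluster point of the measures.

Large dimension: the mass of a ball of radius `r ≤ 1` after one step is `O(r ^ (d - 1 + α))`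
uniformly in `v` (`setLIntegral_closedBall_periodicBump_le`), so for `s < d - 1 + α` the `s`-energy
near the diagonal is uniformly small. Away from the diagonal the kernel is bounded and continuous,
and the new densities converge weakly to the old one as `v → ∞`. Hence a large `v` raises the energy
by as little as desired (`eventually_rieszEnergy_slabDensity_le`), and the limit measure has finite
energy.

Small projections: for `v = N • e` the projection to `e` lies near `N⁻¹ ℤ`, which makes it `τ`-null
for `τ > α` (`hausdorffMeasure_eq_zero_of_near_lattice`). Injectivity: for the tilted frequency `v =
N • e - (1 / 2) • e_j`, two points with equal projection to `e` have phases differing by half their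
`j`-th coordinate difference, which must then be at most `2 * η`. Every direction and every tilt
recurs infinitely often.

A slab covering (`dimH_le_dimH_inner_image_add`) bounds `dimH Γ` by `d - 1` plus the dimension of a
projection, which gives the upper bound for `Γ` and the lower bound for the projections. Letting `α`
decrease to `t` gives finite critical energy, hence (1); letting it increase to `t` gives null
projections, hence (2). The case `d = 1`, `t = 0` of (1) is settled by a convergent sequence. -/

noncomputable section

/-! ### Periodic bumps on the real line -/

/-- The `1`-periodic tent function of half-width `η` and height `1`. -/
def periodicTent (η u : ℝ) : ℝ := max 0 (1 - ‖(u : UnitAddCircle)‖ / η)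

/-- The `1`-periodic tent function of half-width `η`, normalized to have mean `1`. -/
def periodicBump (η u : ℝ) : ℝ := periodicTent η u / ∫ s in (0 : ℝ)..1, periodicTent η s

lemma continuous_periodicTent (η : ℝ) : Continuous (periodicTent η) := by
  have h : Continuous fun u : ℝ => (u : UnitAddCircle) := AddCircle.continuous_mk' 1
  unfold periodicTent
  fun_prop

lemma periodicTent_nonneg (η u : ℝ) : 0 ≤ periodicTent η u := le_max_left _ _

lemma periodicTent_le_one {η : ℝ} (hη : 0 < η) (u : ℝ) : periodicTent η u ≤ 1 :=
  max_le zero_le_one (by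
    have : 0 ≤ ‖(u : UnitAddCircle)‖ / η := by positivity
    linarith)

lemma periodic_periodicTent (η : ℝ) : Function.Periodic (periodicTent η) 1 := by
  intro u
  have : ((u + 1 : ℝ) : UnitAddCircle) = u := AddCircle.coe_add_period 1 u
  simp only [periodicTent, this]

/-- On `[0, η / 2]` the tent is at least `1 / 2`; this crude bound gives the height `4 / η` of the
normalized bump. -/
lemma le_integral_periodicTent {η : ℝ} (hη : 0 < η) (hη' : η ≤ 1 / 2) :
    η / 4 ≤ ∫ s in (0 : ℝ)..1, periodicTent η s := by
  have hi : ∀ a b, IntervalIntegrable (periodicTent η) volume a b := fun a b =>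
    (continuous_periodicTent η).intervalIntegrable a b
  have h1 : ∫ s in (0 : ℝ)..(η / 2), (1 / 2 : ℝ) ≤ ∫ s in (0 : ℝ)..(η / 2), periodicTent η s := by
    apply intervalIntegral.integral_mono_on (by positivity) (by simp) (hi _ _)
    intro x hx
    refine le_trans ?_ (le_max_right _ _)
    have : ‖(x : UnitAddCircle)‖ ≤ |x| := by
      rw [UnitAddCircle.norm_eq]
      simpa using round_le x 0
    have h2 : ‖(x : UnitAddCircle)‖ / η ≤ 1 / 2 := by
      rw [div_le_iff₀ hη]
      rw [abs_of_nonneg hx.1] at this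
      linarith [hx.2]
    linarith
  have h2 : 0 ≤ ∫ s in (η / 2)..1, periodicTent η s :=
    intervalIntegral.integral_nonneg (by linarith) fun x _ => periodicTent_nonneg η x
  rw [← intervalIntegral.integral_add_adjacent_intervals (hi 0 (η / 2)) (hi (η / 2) 1)]
  simp only [intervalIntegral.integral_const, smul_eq_mul, sub_zero] at h1
  linarith

lemma continuous_periodicBump (η : ℝ) : Continuous (periodicBump η) :=
  (continuous_periodicTent η).div_const _

lemma periodicBump_nonneg (η u : ℝ) : 0 ≤ periodicBump η u :=
  div_nonneg (periodicTent_nonneg _ _)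
    (intervalIntegral.integral_nonneg zero_le_one fun x _ => periodicTent_nonneg η x)

lemma periodic_periodicBump (η : ℝ) : Function.Periodic (periodicBump η) 1 := fun u => by
  simp only [periodicBump, periodic_periodicTent η u]

lemma integral_periodicBump {η : ℝ} (hη : 0 < η) (hη' : η ≤ 1 / 2) (a : ℝ) :
    ∫ s in a..(a + 1), periodicBump η s = 1 := by
  rw [(periodic_periodicBump η).intervalIntegral_add_eq a 0, zero_add]
  have := le_integral_periodicTent hη hη'
  simp only [periodicBump, intervalIntegral.integral_div]
  exact div_self (by linarith)

lemma periodicBump_le {η : ℝ} (hη : 0 < η) (hη' : η ≤ 1 / 2) (u : ℝ) :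
    periodicBump η u ≤ 4 / η := by
  have h := le_integral_periodicTent hη hη'
  calc periodicBump η u ≤ 1 / (η / 4) :=
        div_le_div₀ zero_le_one (periodicTent_le_one hη u) (by positivity) h
    _ = 4 / η := by field_simp

lemma norm_coe_le_of_periodicBump_ne_zero {η : ℝ} (hη : 0 < η) {u : ℝ}
    (h : periodicBump η u ≠ 0) : ‖(u : UnitAddCircle)‖ ≤ η := by
  by_contra! h'
  apply h
  have : 1 ≤ ‖(u : UnitAddCircle)‖ / η := by rw [le_div_iff₀ hη]; linarith
  simp [periodicBump, periodicTent, max_eq_left (show 1 - ‖(u : UnitAddCircle)‖ / η ≤ 0 by linarith)]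

/-- Round the length up to `⌈R⌉` full periods. This is the efficient bound on long intervals; the
sup bound in `integral_periodicBump_le_mul` serves the short ones. -/
lemma integral_periodicBump_le_add_one {η : ℝ} (hη : 0 < η) (hη' : η ≤ 1 / 2) (a : ℝ) {R : ℝ}
    (hR : 0 ≤ R) : ∫ s in a..(a + R), periodicBump η s ≤ R + 1 := by
  have hi : ∀ a b, IntervalIntegrable (periodicBump η) volume a b := fun a b =>
    (continuous_periodicBump η).intervalIntegrable a b
  have h1 := (periodic_periodicBump η).intervalIntegral_add_zsmul_eq ⌈R⌉ a hi
  rw [integral_periodicBump hη hη'] at h1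
  simp only [zsmul_eq_mul, mul_one] at h1
  have h2 : ∫ s in a..(a + R), periodicBump η s ≤ ∫ s in a..(a + ⌈R⌉), periodicBump η s :=
    intervalIntegral.integral_mono_interval le_rfl (by linarith)
      (by linarith [Int.le_ceil R]) (Eventually.of_forall fun x => periodicBump_nonneg η x) (hi _ _)
  linarith [Int.ceil_lt_add_one R]

lemma integral_periodicBump_le_mul {η : ℝ} (hη : 0 < η) (hη' : η ≤ 1 / 2) (a : ℝ) {R : ℝ}
    (hR : 0 ≤ R) : ∫ s in a..(a + R), periodicBump η s ≤ R * (4 / η) := by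
  have h2 : ∫ s in a..(a + R), periodicBump η s ≤ ∫ s in a..(a + R), (4 / η) :=
    intervalIntegral.integral_mono_on (by linarith)
      ((continuous_periodicBump η).intervalIntegrable _ _) (by simp)
      fun x _ => periodicBump_le hη hη' x
  simpa [mul_div_assoc] using h2

lemma setLIntegral_periodicBump_Icc (η : ℝ) (a : ℝ) {R : ℝ} (hR : 0 ≤ R) :
    ∫⁻ s in Icc a (a + R), ENNReal.ofReal (periodicBump η s) =
      ENNReal.ofReal (∫ s in a..(a + R), periodicBump η s) := by
  rw [intervalIntegral.integral_of_le (by linarith), ← integral_Icc_eq_integral_Ioc,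
    ofReal_integral_eq_lintegral_ofReal]
  · exact (continuous_periodicBump η).continuousOn.integrableOn_Icc
  · exact Eventually.of_forall fun x => periodicBump_nonneg η x

/-- At frequency `N` and half-width `N ^ (1 - 1 / α)`, the rescaled bumps are uniformly
`α`-dimensional. -/
lemma integral_periodicBump_le_rpow {α N r : ℝ} (hα : 0 < α) (hα1 : α < 1) (hN : 0 < N)
    (hη' : N ^ (1 - 1 / α) ≤ 1 / 2) (hr : 0 < r) (hr1 : r ≤ 1) (a : ℝ) :
    (∫ s in a..(a + 2 * r * N), periodicBump (N ^ (1 - 1 / α)) s) / N ≤ 8 * r ^ α := by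
  have hη : 0 < N ^ (1 - 1 / α) := Real.rpow_pos_of_pos hN _
  have hR : 0 ≤ 2 * r * N := by positivity
  have h1 := integral_periodicBump_le_add_one hη hη' a hR
  have h2 := integral_periodicBump_le_mul hη hη' a hR
  set I := ∫ s in a..(a + 2 * r * N), periodicBump (N ^ (1 - 1 / α)) s
  have hrα : r ≤ r ^ α := by
    simpa using Real.rpow_le_rpow_of_exponent_ge hr hr1 hα1.le
  rcases le_total 1 (2 * r * N) with h | h
  · rw [div_le_iff₀ hN]
    have : r * N ≤ r ^ α * N := by gcongr
    nlinarith
  · -- compare with the two bounds according to the size of `x = r N / η`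
    set x := r * N / N ^ (1 - 1 / α) with hx
    have hx0 : 0 < x := by positivity
    have hI2 : I ≤ 8 * x := by rw [hx]; calc I ≤ _ := h2
      _ = _ := by ring
    -- The exponent `1 - 1 / α` is chosen for this identity. Since `I ≤ min 2 (8 * x)` here, it
    -- remains to compare `min 1 x` with `x ^ α`.
    have hxα : x ^ α = r ^ α * N := by
      have : x = r * N ^ (1 / α) := by
        rw [hx, mul_div_assoc, Real.rpow_sub hN, Real.rpow_one]; field_simp
      rw [this, Real.mul_rpow hr.le (by positivity), ← Real.rpow_mul hN.le,
        one_div_mul_cancel hα.ne', Real.rpow_one]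
    rw [div_le_iff₀ hN, mul_assoc, ← hxα]
    rcases le_total x 1 with h3 | h3
    · have : x ≤ x ^ α := by simpa using Real.rpow_le_rpow_of_exponent_ge hx0 h3 hα1.le
      linarith
    · have : 1 ≤ x ^ α := Real.one_le_rpow h3 hα.le
      linarith

/-! ### Averaging of oscillating bumps -/

section Averaging

variable {V : Type*} [NormedAddCommGroup V] [InnerProductSpace ℝ V] [FiniteDimensional ℝ V]
  [MeasurableSpace V] [BorelSpace V]

/-- Multiplying a function by a bump oscillating in the direction `v` changes its integral by at
most its oscillation at scale `‖v‖⁻¹`. -/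
lemma abs_integral_mul_periodicBump_sub_le {h : V → ℝ} (hc : Continuous h)
    {R : ℝ} (hR : ∀ x, R < ‖x‖ → h x = 0) {η : ℝ} (hη : 0 < η) (hη' : η ≤ 1 / 2) {v : V}
    (hv : 1 ≤ ‖v‖) {ε : ℝ} (hε : ∀ x y, dist x y ≤ ‖v‖⁻¹ → |h x - h y| ≤ ε) :
    |(∫ x, h x * periodicBump η ⟪x, v⟫) - ∫ x, h x| ≤
      ε * volume.real (closedBall (0 : V) (R + 1)) := by
  set B := closedBall (0 : V) (R + 1)
  set g := periodicBump η
  have hg : Continuous g := continuous_periodicBump η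
  have hv0 : 0 < ‖v‖ := by linarith
  -- Translation by `τ • p` advances the phase `⟪x, v⟫` by exactly `τ` and moves points by at most
  -- `‖v‖⁻¹` for `τ ∈ [0, 1]`. Averaging over `τ` and applying Fubini integrates the bump to `1` at
  -- each `x`.
  set p : V := (‖v‖ ^ 2)⁻¹ • v
  have hp : ‖p‖ = ‖v‖⁻¹ := by
    simp only [p, norm_smul, norm_inv, norm_pow, norm_norm]
    field_simp
  have hpv : ⟪p, v⟫ = 1 := by
    simp only [p, real_inner_smul_left, real_inner_self_eq_norm_sq]
    field_simp
  have hp1 : ‖p‖ ≤ 1 := by rw [hp]; exact inv_le_one_of_one_le₀ hv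
  have hcs : HasCompactSupport h := HasCompactSupport.intro (isCompact_closedBall (0 : V) R)
    fun x hx => hR x (by simpa using hx)
  obtain ⟨M, hM⟩ := hcs.exists_bound_of_continuous hc
  have hM0 : 0 ≤ M := (norm_nonneg _).trans (hM 0)
  have hout : ∀ τ ∈ Icc (0 : ℝ) 1, ∀ x ∉ B, h (x + τ • p) = 0 := by
    intro τ hτ x hx
    apply hR
    have hx' : R + 1 < ‖x‖ := by simpa [B] using hx
    have h1 : ‖τ • p‖ ≤ 1 := by
      rw [norm_smul, Real.norm_of_nonneg hτ.1]
      exact mul_le_one₀ hτ.2 (norm_nonneg _) hp1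
    have h2 : ‖x‖ ≤ ‖x + τ • p‖ + ‖τ • p‖ := by
      simpa using norm_sub_le (x + τ • p) (τ • p)
    linarith
  have hBfin : volume B ≠ ⊤ := measure_closedBall_lt_top.ne
  have : IsFiniteMeasure ((volume : Measure ℝ).restrict (uIoc 0 1)) := by
    rw [uIoc_of_le zero_le_one]; infer_instance
  have : IsFiniteMeasure (volume.restrict B) := ⟨by simpa using hBfin.lt_top⟩
  have hshift : ∀ τ ∈ Icc (0 : ℝ) 1, ∫ x, h x * g ⟪x, v⟫ =
      ∫ x in B, h (x + τ • p) * g (⟪x, v⟫ + τ) := by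
    intro τ hτ
    rw [setIntegral_eq_integral_of_forall_compl_eq_zero
      (fun x hx => by rw [hout τ hτ x hx, zero_mul]),
      ← integral_add_right_eq_self (fun x => h x * g ⟪x, v⟫) (τ • p)]
    simp only [inner_add_left, real_inner_smul_left, hpv, mul_one]
  have h1 : ∫ x, h x * g ⟪x, v⟫ =
      ∫ τ in (0 : ℝ)..1, ∫ x in B, h (x + τ • p) * g (⟪x, v⟫ + τ) := by
    rw [intervalIntegral.integral_congr (g := fun _ => ∫ x, h x * g ⟪x, v⟫)]
    · simp
    · intro τ hτ
      rw [uIcc_of_le zero_le_one] at hτ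
      exact (hshift τ hτ).symm
  have hint : Integrable (Function.uncurry fun (τ : ℝ) (x : V) => h (x + τ • p) * g (⟪x, v⟫ + τ))
      ((volume.restrict (uIoc 0 1)).prod (volume.restrict B)) := by
    apply Integrable.of_bound (C := M * (4 / η))
    · apply Continuous.aestronglyMeasurable
      unfold Function.uncurry
      fun_prop
    · refine Eventually.of_forall fun z => ?_
      simp only [Function.uncurry, norm_mul]
      have h4 : ‖g (⟪z.2, v⟫ + z.1)‖ ≤ 4 / η := by
        rw [Real.norm_of_nonneg (periodicBump_nonneg _ _)]
        exact periodicBump_le hη hη' _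
      gcongr
      exact hM _
  rw [intervalIntegral_integral_swap hint] at h1
  have h2 : ∫ x, h x = ∫ x in B, h x := by
    rw [setIntegral_eq_integral_of_forall_compl_eq_zero]
    intro x hx
    simpa using hout 0 (by simp) x hx
  have hhi : Integrable h (volume.restrict B) := by
    apply Integrable.of_bound (C := M) hc.aestronglyMeasurable (Eventually.of_forall hM)
  have hint' : Integrable (fun y => ∫ τ in (0 : ℝ)..1, h (y + τ • p) * g (⟪y, v⟫ + τ))
      (volume.restrict B) := by
    simpa only [intervalIntegral.integral_of_le zero_le_one, uIoc_of_le (zero_le_one' ℝ),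
      Function.uncurry] using hint.integral_prod_right
  rw [h1, h2, ← integral_sub hint' hhi, ← Real.norm_eq_abs]
  refine norm_setIntegral_le_of_norm_le_const hBfin.lt_top fun x _ => ?_
  have hgi : ∫ τ in (0 : ℝ)..1, g (⟪x, v⟫ + τ) = 1 := by
    rw [intervalIntegral.integral_comp_add_left (fun s => g s)]
    simpa using integral_periodicBump hη hη' ⟪x, v⟫
  have hgc : Continuous fun τ => g (⟪x, v⟫ + τ) := by fun_prop
  have h3 : (∫ τ in (0 : ℝ)..1, h (x + τ • p) * g (⟪x, v⟫ + τ)) - h x =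
      ∫ τ in (0 : ℝ)..1, (h (x + τ • p) - h x) * g (⟪x, v⟫ + τ) := by
    simp only [sub_mul]
    rw [intervalIntegral.integral_sub, intervalIntegral.integral_const_mul, hgi, mul_one]
    · exact Continuous.intervalIntegrable (by fun_prop) _ _
    · exact Continuous.intervalIntegrable (by fun_prop) _ _
  rw [h3]
  calc ‖∫ τ in (0 : ℝ)..1, (h (x + τ • p) - h x) * g (⟪x, v⟫ + τ)‖
      ≤ ∫ τ in (0 : ℝ)..1, ε * g (⟪x, v⟫ + τ) := by
        apply intervalIntegral.norm_integral_le_of_norm_le zero_le_one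
        · refine Eventually.of_forall fun τ hτ => ?_
          rw [norm_mul, Real.norm_of_nonneg (periodicBump_nonneg _ _), Real.norm_eq_abs]
          have := periodicBump_nonneg η (⟪x, v⟫ + τ)
          gcongr
          apply hε
          rw [dist_eq_norm, add_sub_cancel_left, norm_smul, hp, Real.norm_of_nonneg hτ.1.le]
          exact mul_le_of_le_one_left (by positivity) hτ.2
        · exact Continuous.intervalIntegrable (by fun_prop) _ _
    _ = ε := by rw [intervalIntegral.integral_const_mul, hgi, mul_one]

/-- The error bound involves only the oscillation of `h` at scale `‖v‖⁻¹`, so the half-width may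
shrink with `v` at any rate. -/
lemma tendsto_integral_mul_periodicBump {h : V → ℝ} (hc : Continuous h)
    (hcs : HasCompactSupport h) {η : V → ℝ}
    (hη : ∀ᶠ v in Bornology.cobounded V, 0 < η v ∧ η v ≤ 1 / 2) :
    Tendsto (fun v => ∫ x, h x * periodicBump (η v) ⟪x, v⟫) (Bornology.cobounded V)
      (𝓝 (∫ x, h x)) := by
  obtain ⟨R, hR⟩ := (isBounded_iff_forall_norm_le.1 hcs.isCompact.isBounded)
  have hR' : ∀ x, R < ‖x‖ → h x = 0 := by
    intro x hx
    by_contra h0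
    exact absurd (hR x (subset_tsupport _ h0)) (not_le.2 hx)
  set A := volume.real (closedBall (0 : V) (R + 1))
  rw [Metric.tendsto_nhds]
  intro ε hε
  have hA : 0 ≤ A := measureReal_nonneg
  obtain ⟨δ, hδ, hδ'⟩ := Metric.uniformContinuous_iff.1
    (hcs.uniformContinuous_of_continuous hc) (ε / (2 * (A + 1))) (by positivity)
  have hnorm := tendsto_norm_cobounded_atTop (E := V)
  filter_upwards [hη, hnorm.eventually_ge_atTop 1, hnorm.eventually_gt_atTop δ⁻¹]
    with v hv hv1 hv2
  rw [Real.dist_eq]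
  refine (abs_integral_mul_periodicBump_sub_le hc hR' hv.1 hv.2 hv1
    (ε := ε / (2 * (A + 1))) ?_).trans_lt ?_
  · intro x y hxy
    have : ‖v‖⁻¹ < δ := inv_lt_of_inv_lt₀ hδ hv2
    have := hδ' (hxy.trans_lt this)
    rw [Real.dist_eq] at this
    exact this.le
  · rw [div_mul_eq_mul_div, div_lt_iff₀ (by positivity)]
    nlinarith

end Averaging

/-! ### Mass of balls under a slab density -/

section BallEstimates

variable {d : ℕ}

/-- In an orthonormal basis containing `v / ‖v‖` the set lies in a box: sides `2 * r` in the other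
`d - 1` coordinates, and the rescaled `J` in the direction of `v`. -/
lemma volume_closedBall_inter_preimage_inner_le (hd : 1 ≤ d) {v : EuclideanSpace ℝ (Fin d)}
    (hv : v ≠ 0) (x : EuclideanSpace ℝ (Fin d)) {r : ℝ} (hr : 0 ≤ r) {J : Set ℝ}
    (hJ : MeasurableSet J) :
    volume (closedBall x r ∩ (fun y => ⟪y, v⟫) ⁻¹' J) ≤
      ENNReal.ofReal ((2 * r) ^ (d - 1) / ‖v‖) * volume J := by
  have hv0 : 0 < ‖v‖ := norm_pos_iff.2 hv
  let i₀ : Fin d := ⟨0, hd⟩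
  obtain ⟨b, hb⟩ := Orthonormal.exists_orthonormalBasis_extension_of_card_eq (𝕜 := ℝ)
    (E := EuclideanSpace ℝ (Fin d)) (ι := Fin d) (by simp) (v := fun _ => ‖v‖⁻¹ • v) (s := {i₀}) (by
      rw [orthonormal_iff_ite]
      rintro ⟨i, rfl⟩ ⟨j, rfl⟩
      have h1 : ‖‖v‖⁻¹ • v‖ = 1 := by
        rw [norm_smul, norm_inv, norm_norm, inv_mul_cancel₀ hv0.ne']
      simp [h1])
  have hb0 : b i₀ = ‖v‖⁻¹ • v := hb i₀ rfl
  have hmp : MeasurePreserving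
      (fun y => (MeasurableEquiv.toLp 2 (Fin d → ℝ)).symm (b.repr y)) volume volume :=
    (EuclideanSpace.volume_preserving_symm_measurableEquiv_toLp (Fin d)).comp
      b.measurePreserving_repr
  let S : Fin d → Set ℝ := fun i =>
    if i = i₀ then (fun u => u * ‖v‖) ⁻¹' J else Icc (b.repr x i - r) (b.repr x i + r)
  have hS : ∀ i, MeasurableSet (S i) := by
    intro i
    by_cases h : i = i₀
    · simp only [S, h, if_true]
      exact (measurable_id.mul_const _) hJ
    · simp only [S, h, if_false]
      exact measurableSet_Icc
  have hsub : closedBall x r ∩ (fun y => ⟪y, v⟫) ⁻¹' J ⊆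
      (fun y => (MeasurableEquiv.toLp 2 (Fin d → ℝ)).symm (b.repr y)) ⁻¹' (Set.pi univ S) := by
    rintro y ⟨hy, hyJ⟩
    rw [mem_preimage, Set.mem_univ_pi]
    intro i
    change b.repr y i ∈ S i
    by_cases h : i = i₀
    · simp only [S, h, if_true, mem_preimage]
      have h1 : b.repr y i₀ * ‖v‖ = ⟪y, v⟫ := by
        rw [b.repr_apply_apply, hb0, real_inner_smul_left, real_inner_comm]
        field_simp
      rw [h1]
      exact hyJ
    · simp only [S, h, if_false]
      have h1 : |b.repr y i - b.repr x i| ≤ r := by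
        have h2 : b.repr y i - b.repr x i = b.repr (y - x) i := by simp
        rw [h2, b.repr_apply_apply]
        refine (abs_real_inner_le_norm _ _).trans ?_
        rw [b.orthonormal.1 i, one_mul, ← dist_eq_norm]
        exact hy
      rw [abs_le] at h1
      constructor <;> linarith
  refine (measure_mono hsub).trans ?_
  rw [hmp.measure_preimage (MeasurableSet.univ_pi hS).nullMeasurableSet, volume_pi_pi,
    ← Finset.mul_prod_erase _ _ (Finset.mem_univ i₀)]
  have h1 : volume (S i₀) = ENNReal.ofReal ‖v‖⁻¹ * volume J := by
    simp only [S, if_true]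
    rw [Real.volume_preimage_mul_right hv0.ne', abs_of_pos (inv_pos.2 hv0)]
  have h2 : ∏ i ∈ Finset.univ.erase i₀, volume (S i) = ENNReal.ofReal ((2 * r) ^ (d - 1)) := by
    rw [Finset.prod_congr rfl (g := fun _ => ENNReal.ofReal (2 * r))]
    · rw [Finset.prod_const, Finset.card_erase_of_mem (Finset.mem_univ _), Finset.card_fin,
        ENNReal.ofReal_pow (by positivity)]
    · intro i hi
      simp only [S, Finset.ne_of_mem_erase hi, if_false, Real.volume_Icc]
      congr 1
      ring
  rw [h1, h2, mul_right_comm, ← ENNReal.ofReal_mul (by positivity), div_eq_inv_mul]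

/-- Pushing volume on the ball forward under `⟪·, v⟫` reduces this to
`integral_periodicBump_le_rpow`. The bound does not depend on `v`, which is what makes the energy
estimate uniform. -/
lemma setLIntegral_closedBall_periodicBump_le (hd : 1 ≤ d) {v : EuclideanSpace ℝ (Fin d)}
    (hv : v ≠ 0) {α : ℝ} (hα : 0 < α) (hα1 : α < 1) (hη : ‖v‖ ^ (1 - 1 / α) ≤ 1 / 2)
    (x : EuclideanSpace ℝ (Fin d)) {r : ℝ} (hr : 0 < r) (hr1 : r ≤ 1) :
    ∫⁻ y in closedBall x r, ENNReal.ofReal (periodicBump (‖v‖ ^ (1 - 1 / α)) ⟪y, v⟫) ≤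
      ENNReal.ofReal (2 ^ (d - 1) * 8 * r ^ ((d : ℝ) - 1 + α)) := by
  have hv0 : 0 < ‖v‖ := norm_pos_iff.2 hv
  set g := periodicBump (‖v‖ ^ (1 - 1 / α))
  set a := ⟪x, v⟫ - r * ‖v‖ with ha
  have hm : Measurable fun y : EuclideanSpace ℝ (Fin d) => ⟪y, v⟫ := by fun_prop
  have hgm : Measurable fun s => ENNReal.ofReal (g s) :=
    (continuous_periodicBump _).measurable.ennreal_ofReal
  have hle : Measure.map (fun y => ⟪y, v⟫) (volume.restrict (closedBall x r)) ≤
      ENNReal.ofReal ((2 * r) ^ (d - 1) / ‖v‖) •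
        volume.restrict (Icc a (a + 2 * r * ‖v‖)) := by
    refine Measure.le_iff.2 fun J hJ => ?_
    rw [Measure.map_apply hm hJ, Measure.restrict_apply (hm hJ), Measure.smul_apply, smul_eq_mul,
      Measure.restrict_apply hJ]
    refine le_trans (measure_mono ?_) (volume_closedBall_inter_preimage_inner_le hd hv x hr.le
      (hJ.inter measurableSet_Icc))
    rintro y ⟨hyJ, hy⟩
    refine ⟨hy, hyJ, ?_⟩
    have h1 : |⟪y - x, v⟫| ≤ r * ‖v‖ := by
      refine (abs_real_inner_le_norm _ _).trans ?_
      rw [← dist_eq_norm]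
      gcongr
      exact hy
    rw [inner_sub_left, abs_le] at h1
    constructor <;> simp only [ha] <;> linarith
  calc ∫⁻ y in closedBall x r, ENNReal.ofReal (g ⟪y, v⟫)
      = ∫⁻ s, ENNReal.ofReal (g s)
          ∂(Measure.map (fun y => ⟪y, v⟫) (volume.restrict (closedBall x r))) := by
        rw [lintegral_map hgm hm]
    _ ≤ ENNReal.ofReal ((2 * r) ^ (d - 1) / ‖v‖) *
          ENNReal.ofReal (∫ s in a..(a + 2 * r * ‖v‖), g s) := by
        refine (lintegral_mono' hle le_rfl).trans_eq ?_
        rw [lintegral_smul_measure, smul_eq_mul,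
          setLIntegral_periodicBump_Icc _ _ (by positivity)]
    _ = ENNReal.ofReal ((2 * r) ^ (d - 1) * ((∫ s in a..(a + 2 * r * ‖v‖), g s) / ‖v‖)) := by
        rw [← ENNReal.ofReal_mul (by positivity), mul_div_assoc', div_mul_eq_mul_div]
    _ ≤ ENNReal.ofReal ((2 * r) ^ (d - 1) * (8 * r ^ α)) := by
        gcongr
        exact integral_periodicBump_le_rpow hα hα1 hv0 hη hr hr1 a
    _ = ENNReal.ofReal (2 ^ (d - 1) * 8 * r ^ ((d : ℝ) - 1 + α)) := by
        have : r ^ ((d : ℝ) - 1 + α) = r ^ (d - 1) * r ^ α := by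
          rw [Real.rpow_add hr, ← Nat.cast_one, ← Nat.cast_sub hd, Real.rpow_natCast]
        rw [this, mul_pow]
        ring_nf

end BallEstimates

/-! ### Riesz potentials from ball growth -/

section Potential

variable {X : Type*} [PseudoMetricSpace X] [MeasurableSpace X] [OpensMeasurableSpace X]

/-- A measure whose balls are `β`-dimensional has small local `s`-potentials for `s < β`. -/
lemma setLIntegral_closedBall_edist_rpow_neg_le {s β : ℝ} (hs : 0 ≤ s) (hsβ : s < β) :
    ∃ C : ℝ, 0 ≤ C ∧ ∀ (ν : Measure X) (x : X) (A δ : ℝ), 0 ≤ A → 0 < δ →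
      (∀ r, 0 < r → r ≤ δ → ν (closedBall x r) ≤ ENNReal.ofReal (A * r ^ β)) →
      ∫⁻ y in closedBall x δ, edist x y ^ (-s) ∂ν ≤ ENNReal.ofReal (C * A * δ ^ (β - s)) := by
  set q : ℝ := (1 / 2 : ℝ) ^ (β - s) with hq
  have hq0 : 0 < q := by positivity
  have hq1 : q < 1 := Real.rpow_lt_one (by norm_num) (by norm_num) (by linarith)
  refine ⟨2 ^ s * (1 - q)⁻¹, by have := sub_pos.2 hq1; positivity, ?_⟩
  intro ν x A δ hA hδ hν
  set ρ : ℕ → ℝ := fun j => δ * (1 / 2) ^ j with hρ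
  have hρ0 : ∀ j, 0 < ρ j := fun j => by positivity
  have hρδ : ∀ j, ρ j ≤ δ := fun j =>
    mul_le_of_le_one_right hδ.le (pow_le_one₀ (by norm_num) (by norm_num))
  set c : ℕ → ℝ := fun j => (ρ j / 2) ^ (-s) with hc
  have hc0 : ∀ j, 0 < c j := fun j => by have := hρ0 j; positivity
  -- Dyadic decomposition of the kernel. Full balls instead of annuli also handle `dist x y = 0`,
  -- where infinitely many terms make the sum `⊤`.
  have hpt : ∀ y ∈ closedBall x δ, edist x y ^ (-s) ≤
      ∑' j, (closedBall x (ρ j)).indicator (fun _ => ENNReal.ofReal (c j)) y := by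
    intro y hy
    have hy' : dist x y ≤ δ := by rw [dist_comm]; exact hy
    rcases (dist_nonneg (x := x) (y := y)).eq_or_lt with h0 | h0
    · have : ∀ j, ENNReal.ofReal (δ ^ (-s)) ≤
          (closedBall x (ρ j)).indicator (fun _ => ENNReal.ofReal (c j)) y := by
        intro j
        rw [indicator_of_mem (by rw [mem_closedBall, dist_comm, ← h0]; exact (hρ0 j).le)]
        apply ENNReal.ofReal_le_ofReal
        exact Real.rpow_le_rpow_of_nonpos (by have := hρ0 j; positivity)
          (by linarith [hρδ j, hρ0 j]) (by linarith)
      have h1 : (⊤ : ℝ≥0∞) = ∑' _ : ℕ, ENNReal.ofReal (δ ^ (-s)) := by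
        rw [ENNReal.tsum_const_eq_top_of_ne_zero]
        simp only [ne_eq, ENNReal.ofReal_eq_zero, not_le]
        positivity
      exact le_top.trans (h1.le.trans (ENNReal.tsum_le_tsum this))
    · obtain ⟨j, hj1, hj2⟩ := exists_nat_pow_near_of_lt_one (x := dist x y / δ) (y := (1 / 2 : ℝ))
        (by positivity) ((div_le_one hδ).2 hy') (by norm_num) (by norm_num)
      rw [lt_div_iff₀ hδ] at hj1
      rw [div_le_iff₀ hδ] at hj2
      refine le_trans ?_ (ENNReal.le_tsum j)
      rw [indicator_of_mem (by rw [mem_closedBall, dist_comm, hρ]; linarith), edist_dist,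
        ENNReal.ofReal_rpow_of_pos h0]
      apply ENNReal.ofReal_le_ofReal
      refine Real.rpow_le_rpow_of_nonpos (by have := hρ0 j; positivity) ?_ (by linarith)
      simp only [hρ]
      rw [pow_succ] at hj1
      linarith
  calc ∫⁻ y in closedBall x δ, edist x y ^ (-s) ∂ν
      ≤ ∫⁻ y in closedBall x δ,
          ∑' j, (closedBall x (ρ j)).indicator (fun _ => ENNReal.ofReal (c j)) y ∂ν :=
        setLIntegral_mono' measurableSet_closedBall hpt
    _ ≤ ∫⁻ y, ∑' j, (closedBall x (ρ j)).indicator (fun _ => ENNReal.ofReal (c j)) y ∂ν :=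
        setLIntegral_le_lintegral _ _
    _ = ∑' j, ENNReal.ofReal (c j) * ν (closedBall x (ρ j)) := by
        rw [lintegral_tsum fun j =>
          (measurable_const.indicator measurableSet_closedBall).aemeasurable]
        congr 1 with j
        rw [lintegral_indicator_const measurableSet_closedBall]
    _ ≤ ∑' j, ENNReal.ofReal (2 ^ s * A * δ ^ (β - s) * q ^ j) := by
        refine ENNReal.tsum_le_tsum fun j => ?_
        refine (mul_le_mul_right (hν _ (hρ0 j) (hρδ j)) _).trans_eq ?_
        rw [← ENNReal.ofReal_mul (hc0 j).le]
        congr 1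
        simp only [hc, hρ, hq]
        have h2 : (δ * (1 / 2) ^ j / 2) ^ (-s) = 2 ^ s * (δ * (1 / 2) ^ j) ^ (-s) := by
          rw [Real.div_rpow (by positivity) (by norm_num), Real.rpow_neg (x := 2) (by norm_num)]
          field_simp
        have h3 : (δ * (1 / 2) ^ j) ^ (-s) * (δ * (1 / 2) ^ j) ^ β =
            δ ^ (β - s) * ((1 / 2 : ℝ) ^ (β - s)) ^ j := by
          rw [← Real.rpow_add (by positivity), neg_add_eq_sub, Real.mul_rpow hδ.le (by positivity),
            ← Real.rpow_natCast, ← Real.rpow_natCast, ← Real.rpow_mul (by norm_num),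
            ← Real.rpow_mul (by norm_num), mul_comm (j : ℝ)]
        rw [h2, mul_assoc (2 ^ s * A), ← h3]
        ring
    _ = ENNReal.ofReal (2 ^ s * (1 - q)⁻¹ * A * δ ^ (β - s)) := by
        rw [← ENNReal.ofReal_tsum_of_nonneg (fun j => by positivity)
          ((summable_geometric_of_lt_one hq0.le hq1).mul_left _), tsum_mul_left,
          tsum_geometric_of_lt_one hq0.le hq1]
        congr 1
        ring

end Potential

/-! ### Truncated energies and weak convergence -/

section Energy

variable {d : ℕ}

/-- The Riesz kernel, truncated at height `M`, as a bounded continuous function. -/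
def truncatedKernel (d : ℕ) (s : ℝ) (M : ℝ≥0) : BoundedContinuousFunction
    (EuclideanSpace ℝ (Fin d) × EuclideanSpace ℝ (Fin d)) ℝ≥0 :=
  BoundedContinuousFunction.mkOfBound
    ⟨fun p => (min (edist p.1 p.2 ^ (-s)) M).toNNReal, by
      refine ENNReal.continuousOn_toNNReal.comp_continuous ?_ ?_
      · exact (ENNReal.continuous_rpow_const.comp (continuous_fst.edist continuous_snd)).min
          continuous_const
      · intro p
        exact ne_top_of_le_ne_top ENNReal.coe_ne_top (min_le_right _ _)⟩ M (by
    intro p q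
    have h : ∀ a : ℝ≥0∞, ((min a M).toNNReal : ℝ) ≤ M := fun a => by
      rw [NNReal.coe_le_coe]
      simpa using ENNReal.toNNReal_mono ENNReal.coe_ne_top (min_le_right a (M : ℝ≥0∞))
    rw [NNReal.dist_eq]
    refine abs_sub_le_of_nonneg_of_le (NNReal.coe_nonneg _) (h _) (NNReal.coe_nonneg _) (h _))

lemma coe_truncatedKernel (s : ℝ) (M : ℝ≥0)
    (p : EuclideanSpace ℝ (Fin d) × EuclideanSpace ℝ (Fin d)) :
    (truncatedKernel d s M p : ℝ≥0∞) = min (edist p.1 p.2 ^ (-s)) M :=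
  ENNReal.coe_toNNReal (ne_top_of_le_ne_top ENNReal.coe_ne_top (min_le_right _ _))

/-- The energy of a measure for the truncated Riesz kernel. -/
def truncatedEnergy (s : ℝ) (M : ℝ≥0) (μ : Measure (EuclideanSpace ℝ (Fin d))) : ℝ≥0∞ :=
  ∫⁻ p, truncatedKernel d s M p ∂(μ.prod μ)

lemma measurable_edist_rpow (s : ℝ) : Measurable
    fun p : EuclideanSpace ℝ (Fin d) × EuclideanSpace ℝ (Fin d) => edist p.1 p.2 ^ (-s) :=
  (measurable_fst.edist measurable_snd).pow_const _

lemma rieszEnergy_eq_lintegral_prod (s : ℝ) (μ : Measure (EuclideanSpace ℝ (Fin d))) [SFinite μ] :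
    rieszEnergy s μ = ∫⁻ p, edist p.1 p.2 ^ (-s) ∂(μ.prod μ) := by
  rw [lintegral_prod _ (measurable_edist_rpow s).aemeasurable]
  rfl

lemma truncatedEnergy_le_rieszEnergy (s : ℝ) (M : ℝ≥0) (μ : Measure (EuclideanSpace ℝ (Fin d)))
    [SFinite μ] : truncatedEnergy s M μ ≤ rieszEnergy s μ := by
  rw [rieszEnergy_eq_lintegral_prod]
  refine lintegral_mono fun p => ?_
  rw [coe_truncatedKernel]
  exact min_le_left _ _

lemma rieszEnergy_le_of_truncatedEnergy_le {s : ℝ} {μ : Measure (EuclideanSpace ℝ (Fin d))}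
    [SFinite μ] {C : ℝ≥0∞} (h : ∀ M : ℕ, truncatedEnergy s M μ ≤ C) : rieszEnergy s μ ≤ C := by
  rw [rieszEnergy_eq_lintegral_prod]
  have h1 : ∀ p : EuclideanSpace ℝ (Fin d) × EuclideanSpace ℝ (Fin d),
      edist p.1 p.2 ^ (-s) = ⨆ M : ℕ, (truncatedKernel d s M p : ℝ≥0∞) := by
    intro p
    simp only [coe_truncatedKernel]
    have := inf_iSup_eq (edist p.1 p.2 ^ (-s)) (fun M : ℕ => ((M : ℝ≥0) : ℝ≥0∞))
    simp only [ENNReal.coe_natCast, ENNReal.iSup_natCast, inf_top_eq] at this ⊢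
    exact this
  simp only [h1]
  rw [lintegral_iSup]
  · exact iSup_le h
  · intro M
    exact (truncatedKernel d s M).continuous.measurable.coe_nnreal_ennreal
  · intro M N hMN p
    simp only [coe_truncatedKernel]
    gcongr

/-- Weak convergence passes to the product measures, and the truncated kernel is an admissible test
function on the product. -/
lemma tendsto_truncatedEnergy (s : ℝ) (M : ℝ≥0) {ι : Type*} {l : Filter ι}
    {μs : ι → ProbabilityMeasure (EuclideanSpace ℝ (Fin d))}
    {μ : ProbabilityMeasure (EuclideanSpace ℝ (Fin d))} (h : Tendsto μs l (𝓝 μ)) :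
    Tendsto (fun i => truncatedEnergy s M (μs i : Measure (EuclideanSpace ℝ (Fin d)))) l
      (𝓝 (truncatedEnergy s M (μ : Measure (EuclideanSpace ℝ (Fin d))))) := by
  have h1 : Tendsto (fun i => (μs i).prod (μs i)) l (𝓝 (μ.prod μ)) :=
    ((ProbabilityMeasure.continuous_prod (α := EuclideanSpace ℝ (Fin d))
      (β := EuclideanSpace ℝ (Fin d))).tendsto (μ, μ)).comp (h.prodMk_nhds h)
  exact ProbabilityMeasure.tendsto_iff_forall_lintegral_tendsto.1 h1 (truncatedKernel d s M)

/-- Outside the ball of radius `δ` the kernel is at most `δ ^ (-s)`, so the truncation changes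
nothing there. -/
lemma rieszEnergy_le_truncatedEnergy_add {s : ℝ} (hs : 0 ≤ s) {δ : ℝ} (hδ : 0 < δ)
    (μ : Measure (EuclideanSpace ℝ (Fin d))) [SFinite μ] :
    rieszEnergy s μ ≤ truncatedEnergy s (δ ^ (-s)).toNNReal μ +
      ∫⁻ x, ∫⁻ y in closedBall x δ, edist x y ^ (-s) ∂μ ∂μ := by
  have hm : Measurable fun p : EuclideanSpace ℝ (Fin d) × EuclideanSpace ℝ (Fin d) =>
      (truncatedKernel d s (δ ^ (-s)).toNNReal p : ℝ≥0∞) :=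
    (truncatedKernel d s _).continuous.measurable.coe_nnreal_ennreal
  unfold truncatedEnergy
  rw [lintegral_prod _ hm.aemeasurable, ← lintegral_add_left hm.lintegral_prod_right']
  refine lintegral_mono fun x => ?_
  have hmx : Measurable fun y => (truncatedKernel d s (δ ^ (-s)).toNNReal (x, y) : ℝ≥0∞) :=
    hm.comp measurable_prodMk_left
  rw [← lintegral_indicator measurableSet_closedBall, ← lintegral_add_left hmx]
  refine lintegral_mono fun y => ?_
  by_cases hy : y ∈ closedBall x δ
  · rw [indicator_of_mem hy]
    exact le_add_self
  · rw [indicator_of_notMem hy, add_zero]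
    simp only [coe_truncatedKernel]
    refine le_min le_rfl ?_
    have hy' : δ < dist x y := by simpa [dist_comm] using hy
    rw [edist_dist, ENNReal.ofReal_rpow_of_pos (hδ.trans hy')]
    exact ENNReal.ofReal_le_ofReal (Real.rpow_le_rpow_of_nonpos hδ hy'.le (by linarith))

end Energy

/-! ### Test densities and their slab versions -/

section Density

lemma eventually_rpow_half_width {V : Type*} [NormedAddCommGroup V] {α : ℝ} (hα : 0 < α)
    (hα1 : α < 1) {ε : ℝ} (hε : 0 < ε) :
    ∀ᶠ v in Bornology.cobounded V, 0 < ‖v‖ ^ (1 - 1 / α) ∧ ‖v‖ ^ (1 - 1 / α) ≤ ε := by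
  have hnorm := tendsto_norm_cobounded_atTop (E := V)
  have h0 : 0 < 1 / α - 1 := by
    rw [sub_pos, lt_div_iff₀ hα]; linarith
  have h1 := (tendsto_rpow_neg_atTop h0).comp hnorm
  filter_upwards [hnorm.eventually_ge_atTop 1, h1.eventually_le_const hε] with v hv1 hv2
  refine ⟨by positivity, ?_⟩
  simpa using hv2

variable {V : Type*} [NormedAddCommGroup V] [InnerProductSpace ℝ V] [FiniteDimensional ℝ V]
  [MeasurableSpace V] [BorelSpace V]

/-- A continuous, compactly supported probability density. -/
structure IsTestDensity (f : V → ℝ) : Prop where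
  continuous : Continuous f
  hasCompactSupport : HasCompactSupport f
  nonneg : ∀ x, 0 ≤ f x
  integral_eq_one : ∫ x, f x = 1

/-- The measure with density `f`. -/
def densityMeasure (f : V → ℝ) : Measure V := volume.withDensity fun x => ENNReal.ofReal (f x)

/-- The mass of `f` after multiplication with an oscillating bump of frequency `v`. -/
def slabMass (α : ℝ) (f : V → ℝ) (v : V) : ℝ :=
  ∫ x, f x * periodicBump (‖v‖ ^ (1 - 1 / α)) ⟪x, v⟫

/-- The density `f`, multiplied with an oscillating bump of frequency `v` and normalized. -/
def slabDensity (α : ℝ) (f : V → ℝ) (v : V) (x : V) : ℝ :=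
  f x * periodicBump (‖v‖ ^ (1 - 1 / α)) ⟪x, v⟫ / slabMass α f v

lemma IsTestDensity.integrable {f : V → ℝ} (hf : IsTestDensity f) : Integrable f :=
  hf.continuous.integrable_of_hasCompactSupport hf.hasCompactSupport

lemma IsTestDensity.isProbabilityMeasure {f : V → ℝ} (hf : IsTestDensity f) :
    IsProbabilityMeasure (densityMeasure f) := ⟨by
  rw [densityMeasure, withDensity_apply _ MeasurableSet.univ, Measure.restrict_univ,
    ← ofReal_integral_eq_lintegral_ofReal hf.integrable (Eventually.of_forall hf.nonneg),
    hf.integral_eq_one, ENNReal.ofReal_one]⟩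

lemma integral_densityMeasure {f : V → ℝ} (hf : IsTestDensity f) (φ : V → ℝ) :
    ∫ x, φ x ∂(densityMeasure f) = ∫ x, φ x * f x := by
  rw [densityMeasure, integral_withDensity_eq_integral_toReal_smul]
  · refine integral_congr_ae (Eventually.of_forall fun x => ?_)
    simp [ENNReal.toReal_ofReal (hf.nonneg x), mul_comm]
  · exact hf.continuous.measurable.ennreal_ofReal
  · exact Eventually.of_forall fun x => ENNReal.ofReal_lt_top

lemma tendsto_slabMass {f : V → ℝ} (hf : IsTestDensity f) {α : ℝ} (hα : 0 < α) (hα1 : α < 1) :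
    Tendsto (slabMass α f) (Bornology.cobounded V) (𝓝 1) := by
  rw [← hf.integral_eq_one]
  exact tendsto_integral_mul_periodicBump hf.continuous hf.hasCompactSupport
    (eventually_rpow_half_width hα hα1 (by norm_num))

lemma IsTestDensity.slabDensity {f : V → ℝ} (hf : IsTestDensity f) {α : ℝ} {v : V}
    (h : 0 < slabMass α f v) : IsTestDensity (slabDensity α f v) where
  continuous := by
    have := continuous_periodicBump (‖v‖ ^ (1 - 1 / α))
    have := hf.continuous
    unfold _root_.slabDensity
    fun_prop
  hasCompactSupport := by
    refine hf.hasCompactSupport.mono fun x hx => ?_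
    contrapose! hx
    simp only [Function.mem_support, ne_eq, not_not] at hx
    simp [_root_.slabDensity, hx]
  nonneg x := div_nonneg (mul_nonneg (hf.nonneg x) (periodicBump_nonneg _ _)) h.le
  integral_eq_one := by
    unfold _root_.slabDensity
    rw [integral_div]
    exact div_self h.ne'

/-- The probability measure of a test density, and a Dirac mass otherwise. -/
def densityProbabilityMeasure (f : V → ℝ) : ProbabilityMeasure V :=
  open Classical in
  if h : IsTestDensity f then ⟨densityMeasure f, h.isProbabilityMeasure⟩
  else ⟨Measure.dirac 0, inferInstance⟩

lemma coe_densityProbabilityMeasure {f : V → ℝ} (hf : IsTestDensity f) :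
    (densityProbabilityMeasure f : Measure V) = densityMeasure f := by
  have : densityProbabilityMeasure f = ⟨densityMeasure f, hf.isProbabilityMeasure⟩ := dif_pos hf
  rw [this, ProbabilityMeasure.coe_mk]

/-- Averaging applies to `φ * f` for the numerator and to `f` for the normalizing mass, which tends
to `1`. -/
lemma tendsto_densityProbabilityMeasure_slabDensity {f : V → ℝ} (hf : IsTestDensity f) {α : ℝ}
    (hα : 0 < α) (hα1 : α < 1) :
    Tendsto (fun v => densityProbabilityMeasure (slabDensity α f v)) (Bornology.cobounded V)
      (𝓝 (densityProbabilityMeasure f)) := by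
  rw [ProbabilityMeasure.tendsto_iff_forall_integral_tendsto]
  intro φ
  have hc := tendsto_slabMass hf hα hα1
  rw [coe_densityProbabilityMeasure hf, integral_densityMeasure hf]
  have h1 := tendsto_integral_mul_periodicBump (h := fun x => φ x * f x)
    (φ.continuous.mul hf.continuous) hf.hasCompactSupport.mul_left
    (eventually_rpow_half_width hα hα1 (show (0 : ℝ) < 1 / 2 by norm_num))
  have h2 := h1.div hc one_ne_zero
  rw [div_one] at h2
  refine h2.congr' ?_
  filter_upwards [hc.eventually_const_lt (show (0 : ℝ) < 1 by norm_num)] with v hv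
  rw [coe_densityProbabilityMeasure (hf.slabDensity hv),
    integral_densityMeasure (hf.slabDensity hv), Pi.div_apply, ← integral_div]
  refine integral_congr_ae (Eventually.of_forall fun x => ?_)
  simp only [slabDensity]
  ring

end Density

/-! ### Energy growth in one slab step -/

section EnergyOfDensity

variable {d : ℕ}

/-- A test density has finite `s`-energy for all `s < d`. -/
lemma IsTestDensity.rieszEnergy_lt_top {f : EuclideanSpace ℝ (Fin d) → ℝ} (hf : IsTestDensity f)
    {s : ℝ} (hs : 0 ≤ s) (hsd : s < d) : rieszEnergy s (densityMeasure f) < ⊤ := by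
  have := hf.isProbabilityMeasure
  obtain ⟨F, hF⟩ := hf.hasCompactSupport.exists_bound_of_continuous hf.continuous
  have hF0 : 0 ≤ F := (norm_nonneg _).trans (hF 0)
  obtain ⟨C, hC, hCb⟩ := setLIntegral_closedBall_edist_rpow_neg_le
    (X := EuclideanSpace ℝ (Fin d)) hs hsd
  set b : ℝ := (volume (ball (0 : EuclideanSpace ℝ (Fin d)) 1)).toReal
  refine (rieszEnergy_le_truncatedEnergy_add hs one_pos _).trans_lt (ENNReal.add_lt_top.2 ⟨?_, ?_⟩)
  · refine (lintegral_mono (g := fun _ => 1) fun p => ?_).trans_lt (by simp)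
    rw [coe_truncatedKernel]
    simp
  · refine (lintegral_mono (g := fun _ => ENNReal.ofReal (C * (F * b) * 1 ^ (d - s)))
      fun x => hCb _ x (F * b) 1 (by positivity) one_pos fun r hr hr1 => ?_).trans_lt (by simp)
    rw [densityMeasure, withDensity_apply _ measurableSet_closedBall]
    refine (lintegral_mono (g := fun _ => ENNReal.ofReal F) fun y =>
      ENNReal.ofReal_le_ofReal ((le_abs_self _).trans (hF y))).trans_eq ?_
    rw [setLIntegral_const, Measure.addHaar_closedBall _ _ hr.le,
      ← ENNReal.ofReal_toReal (measure_ball_lt_top (μ := volume)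
        (x := (0 : EuclideanSpace ℝ (Fin d))) (r := 1)).ne, ← ENNReal.ofReal_mul (by positivity),
      ← ENNReal.ofReal_mul hF0]
    congr 1
    simp only [finrank_euclideanSpace, Fintype.card_fin, Real.rpow_natCast]
    ring

/-- Cutting a test density into sufficiently fine slabs increases its energy only slightly. -/
lemma eventually_rieszEnergy_slabDensity_le (hd : 1 ≤ d) {f : EuclideanSpace ℝ (Fin d) → ℝ}
    (hf : IsTestDensity f) {α : ℝ} (hα : 0 < α) (hα1 : α < 1) {s : ℝ} (hs : 0 ≤ s)
    (hsα : s < d - 1 + α) {ε : ℝ} (hε : 0 < ε) :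
    ∀ᶠ v in Bornology.cobounded (EuclideanSpace ℝ (Fin d)),
      rieszEnergy s (densityMeasure (slabDensity α f v)) ≤
        rieszEnergy s (densityMeasure f) + ENNReal.ofReal ε := by
  have := hf.isProbabilityMeasure
  obtain ⟨F, hF⟩ := hf.hasCompactSupport.exists_bound_of_continuous hf.continuous
  have hF0 : 0 ≤ F := (norm_nonneg _).trans (hF 0)
  obtain ⟨C, hC, hCb⟩ := setLIntegral_closedBall_edist_rpow_neg_le
    (X := EuclideanSpace ℝ (Fin d)) hs hsα
  -- `F` bounds `f`, the factor `2` pays for `slabMass ≥ 1 / 2`, and the rest is the constant of the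
  -- ball estimate.
  set A : ℝ := 2 * F * (2 ^ (d - 1) * 8)
  have hA : 0 ≤ A := by positivity
  have hβ : 0 < (d : ℝ) - 1 + α - s := by linarith
  -- `δ` is fixed before `v`: it makes the near-diagonal part at most `ε / 2` for all large `v` at
  -- once. Weak convergence at this fixed truncation then costs another `ε / 2`.
  obtain ⟨δ, hδ0, hδ1, hδ⟩ : ∃ δ : ℝ, 0 < δ ∧ δ ≤ 1 ∧
      C * A * δ ^ ((d : ℝ) - 1 + α - s) ≤ ε / 2 := by
    have h1 : Tendsto (fun δ : ℝ => C * A * δ ^ ((d : ℝ) - 1 + α - s)) (𝓝[>] 0) (𝓝 0) := by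
      have := ((Real.continuousAt_rpow_const 0 _ (Or.inr hβ.le)).tendsto.const_mul (C * A))
      rw [Real.zero_rpow hβ.ne', mul_zero] at this
      exact this.mono_left nhdsWithin_le_nhds
    obtain ⟨δ, h2, h3⟩ := ((h1.eventually_le_const (half_pos hε)).and
      (Ioc_mem_nhdsGT (show (0 : ℝ) < 1 by norm_num))).exists
    exact ⟨δ, h3.1, h3.2, h2⟩
  have hc := tendsto_slabMass hf hα hα1
  have hE := tendsto_truncatedEnergy s (δ ^ (-s)).toNNReal
    (tendsto_densityProbabilityMeasure_slabDensity hf hα hα1)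
  rw [coe_densityProbabilityMeasure hf] at hE
  have hfin : truncatedEnergy s (δ ^ (-s)).toNNReal (densityMeasure f) ≠ ⊤ := by
    refine ne_top_of_le_ne_top ?_
      (truncatedEnergy_le_rieszEnergy s (δ ^ (-s)).toNNReal (densityMeasure f))
    exact (hf.rieszEnergy_lt_top hs (by linarith)).ne
  have hE' := hE.eventually_le_const (ENNReal.lt_add_right hfin
    (ENNReal.ofReal_pos.2 (half_pos hε)).ne')
  filter_upwards [hc.eventually_const_lt (show (1 / 2 : ℝ) < 1 by norm_num), hE',
    eventually_rpow_half_width hα hα1 (show (0 : ℝ) < 1 / 2 by norm_num),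
    (tendsto_norm_cobounded_atTop (E := EuclideanSpace ℝ (Fin d))).eventually_gt_atTop 0]
    with v hv1 hv2 hv3 hv4
  have hv0 : v ≠ 0 := norm_pos_iff.1 hv4
  have hg : IsTestDensity (slabDensity α f v) := hf.slabDensity (by linarith)
  have := hg.isProbabilityMeasure
  rw [coe_densityProbabilityMeasure hg] at hv2
  have hball : ∀ x r, 0 < r → r ≤ δ → densityMeasure (slabDensity α f v) (closedBall x r) ≤
      ENNReal.ofReal (A * r ^ ((d : ℝ) - 1 + α)) := by
    intro x r hr hrδ
    rw [densityMeasure, withDensity_apply _ measurableSet_closedBall]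
    calc ∫⁻ y in closedBall x r, ENNReal.ofReal (slabDensity α f v y)
        ≤ ∫⁻ y in closedBall x r, ENNReal.ofReal (2 * F) *
            ENNReal.ofReal (periodicBump (‖v‖ ^ (1 - 1 / α)) ⟪y, v⟫) := by
          refine lintegral_mono fun y => ?_
          rw [← ENNReal.ofReal_mul (by positivity)]
          apply ENNReal.ofReal_le_ofReal
          rw [slabDensity, div_le_iff₀ (by linarith)]
          have h1 := periodicBump_nonneg (‖v‖ ^ (1 - 1 / α)) ⟪y, v⟫
          have h2 : f y ≤ F := (le_abs_self _).trans (hF y)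
          have h3 : F ≤ 2 * F * slabMass α f v := by nlinarith
          calc _ ≤ (2 * F * slabMass α f v) * periodicBump (‖v‖ ^ (1 - 1 / α)) ⟪y, v⟫ := by
                gcongr; linarith
            _ = _ := by ring
      _ = ENNReal.ofReal (2 * F) * ∫⁻ y in closedBall x r,
            ENNReal.ofReal (periodicBump (‖v‖ ^ (1 - 1 / α)) ⟪y, v⟫) :=
          lintegral_const_mul' _ _ ENNReal.ofReal_ne_top
      _ ≤ ENNReal.ofReal (2 * F) * ENNReal.ofReal (2 ^ (d - 1) * 8 * r ^ ((d : ℝ) - 1 + α)) := by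
          gcongr
          exact setLIntegral_closedBall_periodicBump_le hd hv0 hα hα1 hv3.2 x hr
            (hrδ.trans hδ1)
      _ = _ := by
          rw [← ENNReal.ofReal_mul (by positivity)]
          congr 1
          ring
  calc rieszEnergy s (densityMeasure (slabDensity α f v))
      ≤ _ + _ := rieszEnergy_le_truncatedEnergy_add hs hδ0 _
    _ ≤ (truncatedEnergy s (δ ^ (-s)).toNNReal (densityMeasure f) + ENNReal.ofReal (ε / 2)) +
          ENNReal.ofReal (ε / 2) := by
        gcongr
        refine (lintegral_mono fun x => (hCb _ x A δ hA hδ0 (hball x)).trans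
          (ENNReal.ofReal_le_ofReal hδ)).trans_eq ?_
        simp
    _ ≤ _ := by
        rw [add_assoc, ← ENNReal.ofReal_add (by positivity) (by positivity), add_halves]
        gcongr
        exact truncatedEnergy_le_rieszEnergy _ _ _

end EnergyOfDensity

/-! ### Finite energy forces infinite Hausdorff measure -/

section EnergyAndHausdorff

variable {d : ℕ}

/-- At points of finite potential, the measure of small balls is `o(r ^ s)`. -/
lemma exists_forall_measure_closedBall_le {s : ℝ} (hs : 0 < s)
    {μ : Measure (EuclideanSpace ℝ (Fin d))} [IsFiniteMeasure μ] {x : EuclideanSpace ℝ (Fin d)}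
    (hx : ∫⁻ y, edist x y ^ (-s) ∂μ ≠ ⊤) {ε : ℝ≥0∞} (hε : 0 < ε) :
    ∃ n : ℕ, ∀ r : ℝ, 0 ≤ r → r ≤ 1 / (n + 1) →
      μ (closedBall x r) ≤ ε * ENNReal.ofReal r ^ s := by
  have hm : Measurable fun y => edist x y ^ (-s) :=
    (measurable_const.edist measurable_id).pow_const _
  have hatom : μ {x} = 0 := by
    by_contra h
    apply hx
    rw [eq_top_iff]
    calc (⊤ : ℝ≥0∞) = ∫⁻ y in {x}, edist x y ^ (-s) ∂μ := by
          rw [Measure.restrict_singleton, lintegral_smul_measure, lintegral_dirac' _ hm]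
          simp [hs, ENNReal.mul_top h]
      _ ≤ _ := setLIntegral_le_lintegral _ _
  have hball : Tendsto (fun n : ℕ => μ (closedBall x (1 / ((n : ℝ) + 1)))) atTop (𝓝 0) := by
    have h1 : ⋂ n : ℕ, closedBall x (1 / ((n : ℝ) + 1)) = {x} := by
      ext y
      simp only [mem_iInter, mem_closedBall, mem_singleton_iff]
      constructor
      · intro h
        exact dist_le_zero.1 (ge_of_tendsto' tendsto_one_div_add_atTop_nhds_zero_nat h)
      · rintro rfl n
        rw [dist_self]
        positivity
    rw [← hatom, ← h1]
    refine tendsto_measure_iInter_atTop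
      (fun n => measurableSet_closedBall.nullMeasurableSet) ?_ ⟨0, measure_ne_top _ _⟩
    intro m n hmn
    exact closedBall_subset_closedBall (Nat.one_div_le_one_div hmn)
  -- Finite potential excludes an atom at `x`, so absolute continuity of the integral makes the
  -- potential of small balls tend to zero; it dominates `r ^ (-s) * μ (closedBall x r)`.
  obtain ⟨n, hn⟩ := ((tendsto_setLIntegral_zero hx hball).eventually_le_const hε).exists
  refine ⟨n, fun r hr hrn => ?_⟩
  rcases hr.eq_or_lt with rfl | hr0
  · simp [hatom]
  have h2 : ENNReal.ofReal r ^ (-s) * μ (closedBall x r) ≤ ε := by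
    calc ENNReal.ofReal r ^ (-s) * μ (closedBall x r)
        = ∫⁻ y in closedBall x r, ENNReal.ofReal r ^ (-s) ∂μ := (setLIntegral_const _ _).symm
      _ ≤ ∫⁻ y in closedBall x r, edist x y ^ (-s) ∂μ := by
          refine setLIntegral_mono' measurableSet_closedBall fun y hy => ?_
          rw [ENNReal.rpow_neg, ENNReal.rpow_neg, ENNReal.inv_le_inv]
          refine ENNReal.rpow_le_rpow ?_ hs.le
          rw [edist_dist, dist_comm]
          exact ENNReal.ofReal_le_ofReal hy
      _ ≤ ∫⁻ y in closedBall x (1 / ((n : ℝ) + 1)), edist x y ^ (-s) ∂μ :=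
          lintegral_mono_set (closedBall_subset_closedBall hrn)
      _ ≤ ε := hn
  have h0 : ENNReal.ofReal r ^ s ≠ 0 := by
    simp [ENNReal.rpow_eq_zero_iff, hr0]
  have h3 : ENNReal.ofReal r ^ s ≠ ⊤ := ENNReal.rpow_ne_top_of_nonneg hs.le ENNReal.ofReal_ne_top
  rw [ENNReal.rpow_neg, mul_comm, ← div_eq_mul_inv, ENNReal.div_le_iff h0 h3] at h2
  exact h2

/-- A set carrying a probability measure of finite `s`-energy has infinite `s`-dimensional
Hausdorff measure. -/
theorem hausdorffMeasure_eq_top_of_rieszEnergy_lt_top {s : ℝ} (hs : 0 < s)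
    {μ : Measure (EuclideanSpace ℝ (Fin d))} [IsProbabilityMeasure μ] (hμ : rieszEnergy s μ < ⊤)
    {K : Set (EuclideanSpace ℝ (Fin d))} (hK : IsClosed K) (hμK : μ Kᶜ = 0) :
    Measure.hausdorffMeasure s K = ⊤ := by
  have hae : ∀ᵐ x ∂μ, ∫⁻ y, edist x y ^ (-s) ∂μ ≠ ⊤ := by
    refine (ae_lt_top ?_ hμ.ne).mono fun x hx => hx.ne
    exact (measurable_edist_rpow s).lintegral_prod_right'
  have hKm : μ K = 1 := (prob_compl_eq_zero_iff hK.measurableSet).1 hμK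
  -- Mass distribution principle on the sets `A n`, which exhaust almost all of `μ`. Because `ε` is
  -- arbitrary, the Hausdorff measure can be neither zero nor finite.
  have key : ∀ ε : ℝ≥0∞, 0 < ε → ε ≠ ⊤ → 1 / 2 ≤ ε * Measure.hausdorffMeasure s K := by
    intro ε hε hε'
    let A : ℕ → Set (EuclideanSpace ℝ (Fin d)) := fun n =>
      {x | ∀ r : ℝ, 0 ≤ r → r ≤ 1 / (n + 1) → μ (closedBall x r) ≤ ε * ENNReal.ofReal r ^ s}
    have hA : Monotone A := by
      intro m n hmn x hx r hr hrn
      exact hx r hr (hrn.trans (Nat.one_div_le_one_div hmn))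
    have hAU : μ (⋃ n, A n) = 1 := by
      rw [← measure_univ (μ := μ)]
      refine measure_congr (eventuallyEq_univ.2 ?_)
      filter_upwards [hae] with x hx
      obtain ⟨n, hn⟩ := exists_forall_measure_closedBall_le hs hx hε
      exact mem_iUnion.2 ⟨n, hn⟩
    obtain ⟨n, hn⟩ : ∃ n, 1 / 2 < μ (A n) := by
      rw [hA.measure_iUnion] at hAU
      refine lt_iSup_iff.1 ?_
      rw [hAU]
      exact ENNReal.half_lt_self one_ne_zero ENNReal.one_ne_top
    have hle : ε⁻¹ • μ.restrict (A n) ≤ Measure.hausdorffMeasure s := by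
      refine Measure.le_hausdorffMeasure s _ (ENNReal.ofReal (1 / (n + 1)))
        (ENNReal.ofReal_pos.2 (by positivity)) fun S hS => ?_
      rw [Measure.smul_apply, smul_eq_mul, ← ENNReal.div_eq_inv_mul]
      refine ENNReal.div_le_of_le_mul' ?_
      have h1 : μ.restrict (A n) S ≤ μ (closure S ∩ A n) := by
        rw [← Measure.restrict_apply isClosed_closure.measurableSet]
        exact measure_mono subset_closure
      refine h1.trans ?_
      rcases (closure S ∩ A n).eq_empty_or_nonempty with h | ⟨x, hxS, hxA⟩
      · simp [h]
      have hfin : ediam S ≠ ⊤ := ne_top_of_le_ne_top ENNReal.ofReal_ne_top hS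
      have h2 := hxA (ediam S).toReal ENNReal.toReal_nonneg
        (ENNReal.toReal_le_of_le_ofReal (by positivity) hS)
      rw [ENNReal.ofReal_toReal hfin] at h2
      refine le_trans (measure_mono ?_) h2
      rintro y ⟨hy, -⟩
      rw [mem_closedBall, dist_edist]
      refine ENNReal.toReal_mono hfin ?_
      rw [← ediam_closure S]
      exact edist_le_ediam_of_mem hy hxS
    have h3 := hle K
    rw [Measure.smul_apply, smul_eq_mul, ← ENNReal.div_eq_inv_mul] at h3
    have h4 : μ.restrict (A n) K = μ (A n) := by
      rw [Measure.restrict_apply hK.measurableSet, inter_comm]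
      exact measure_inter_conull hμK
    rw [h4, ENNReal.div_le_iff hε.ne' hε', mul_comm] at h3
    exact hn.le.trans h3
  by_contra h
  rcases eq_or_ne (Measure.hausdorffMeasure s K) 0 with h0 | h0
  · have := key 1 one_pos ENNReal.one_ne_top
    simp [h0] at this
  -- This `ε` would make the right side of `key` equal to `1 / 4`.
  · have h5 := key (4⁻¹ * (Measure.hausdorffMeasure s K)⁻¹)
      (ENNReal.mul_pos (by simp) (ENNReal.inv_ne_zero.2 h))
      (ENNReal.mul_ne_top (by simp) (ENNReal.inv_ne_top.2 h0))
    rw [mul_assoc, ENNReal.inv_mul_cancel h0 h, mul_one, one_div,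
      ENNReal.inv_le_inv] at h5
    exact absurd h5 (by norm_num)

lemma ofReal_le_dimH_of_rieszEnergy_lt_top {s : ℝ}
    {μ : Measure (EuclideanSpace ℝ (Fin d))} [IsProbabilityMeasure μ] (hμ : rieszEnergy s μ < ⊤)
    {K : Set (EuclideanSpace ℝ (Fin d))} (hK : IsClosed K) (hμK : μ Kᶜ = 0) :
    ENNReal.ofReal s ≤ dimH K := by
  rcases le_or_gt s 0 with h | h
  · simp [ENNReal.ofReal_of_nonpos h]
  · refine le_dimH_of_hausdorffMeasure_eq_top (d := s.toNNReal) ?_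
    rw [Real.coe_toNNReal s h.le]
    exact hausdorffMeasure_eq_top_of_rieszEnergy_lt_top h hμ hK hμK

lemma rieszCapacity_pos_of_rieszEnergy_lt_top {s : ℝ}
    {μ : Measure (EuclideanSpace ℝ (Fin d))} [IsProbabilityMeasure μ] (hμ : rieszEnergy s μ < ⊤)
    {K : Set (EuclideanSpace ℝ (Fin d))} (hK : IsCompact K) (hμK : μ Kᶜ = 0) :
    0 < rieszCapacity s K := by
  refine (ENNReal.inv_pos.2 hμ.ne).trans_le ?_
  unfold rieszCapacity
  exact le_iSup_of_le μ (le_iSup_of_le inferInstance (le_iSup_of_le ⟨K, subset_rfl, hK, hμK⟩ le_rfl))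

end EnergyAndHausdorff

/-! ### Limit measure on a decreasing intersection -/

section Limit

variable {d : ℕ}

/-- Probability measures carried by a decreasing sequence of compact sets have a cluster point
carried by the intersection, with no larger energies. -/
theorem exists_probabilityMeasure_iInter {K : ℕ → Set (EuclideanSpace ℝ (Fin d))}
    (hK : ∀ n, IsCompact (K n)) (hanti : Antitone K)
    (μ : ℕ → ProbabilityMeasure (EuclideanSpace ℝ (Fin d)))
    (hμ : ∀ n, (μ n : Measure (EuclideanSpace ℝ (Fin d))) (K n)ᶜ = 0) :
    ∃ ν : Measure (EuclideanSpace ℝ (Fin d)), IsProbabilityMeasure ν ∧ ν (⋂ n, K n)ᶜ = 0 ∧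
      ∀ (s : ℝ) (C : ℝ≥0∞) (m : ℕ),
        (∀ n ≥ m, rieszEnergy s (μ n : Measure (EuclideanSpace ℝ (Fin d))) ≤ C) →
        rieszEnergy s ν ≤ C := by
  have htight : IsTightMeasureSet
      {x | ∃ ν ∈ range μ, (ν : Measure (EuclideanSpace ℝ (Fin d))) = x} := by
    rw [isTightMeasureSet_iff_exists_isCompact_measure_compl_le]
    intro ε _
    refine ⟨K 0, hK 0, ?_⟩
    rintro _ ⟨_, ⟨n, rfl⟩, rfl⟩
    rw [measure_mono_null (compl_subset_compl.2 (hanti (Nat.zero_le n))) (hμ n)]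
    exact zero_le
  have hcomp := isCompact_closure_of_isTightMeasureSet htight
  -- Prokhorov compactness, with the limit along a hyperfilter replacing a convergent subsequence.
  obtain ⟨ν, -, hν⟩ := hcomp.ultrafilter_le_nhds ((hyperfilter ℕ).map μ)
    (le_principal_iff.2 (mem_map.2 (univ_mem' fun n => subset_closure (mem_range_self n))))
  have hlim : Tendsto μ (hyperfilter ℕ : Filter ℕ) (𝓝 ν) := hν
  have hge : ∀ m : ℕ, ∀ᶠ n in (hyperfilter ℕ : Filter ℕ), m ≤ n := fun m =>
    Nat.hyperfilter_le_atTop (eventually_ge_atTop m)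
  refine ⟨ν, inferInstance, ?_, ?_⟩
  · rw [compl_iInter, measure_iUnion_null_iff]
    intro m
    have h1 := ProbabilityMeasure.le_liminf_measure_open_of_tendsto hlim
      (hK m).isClosed.isOpen_compl
    refine le_antisymm (h1.trans ?_) zero_le
    refine le_trans (liminf_le_of_frequently_le' (x := 0) ?_) le_rfl
    refine Eventually.frequently ((hge m).mono fun n hn => ?_)
    exact (measure_mono_null (compl_subset_compl.2 (hanti hn)) (hμ n)).le
  · intro s C m h
    -- Lower semicontinuity of the energy: each truncated energy converges, and truncations increase
    -- to the full kernel.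
    refine rieszEnergy_le_of_truncatedEnergy_le fun M => ?_
    refine le_of_tendsto (tendsto_truncatedEnergy s M hlim) ((hge m).mono fun n hn => ?_)
    exact (truncatedEnergy_le_rieszEnergy _ _ _).trans (h n hn)

end Limit

/-! ### Coverings: slabs and neighbourhoods of lattices -/

section Covering

/-- A set of zero `τ`-dimensional Hausdorff measure has efficient covers, with positive upper
bounds for the diameters. -/
lemma exists_cover_of_hausdorffMeasure_eq_zero {X : Type*} [EMetricSpace X] [MeasurableSpace X]
    [BorelSpace X] {τ : ℝ} (hτ : 0 < τ) {A : Set X} (hA : Measure.hausdorffMeasure τ A = 0)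
    {ε : ℝ} (hε : 0 < ε) :
    ∃ (S : ℕ → Set X) (r : ℕ → ℝ), (∀ k, 0 < r k) ∧ (∀ k, r k ≤ ε) ∧ A ⊆ ⋃ k, S k ∧
      (∀ k, ediam (S k) ≤ ENNReal.ofReal (r k)) ∧
      ∑' k, ENNReal.ofReal (r k ^ τ) ≤ ENNReal.ofReal (2 * ε) := by
  rw [Measure.hausdorffMeasure_apply] at hA
  have h1 := (le_iSup₂ (f := fun (r : ℝ≥0∞) (_ : 0 < r) =>
    ⨅ (t : ℕ → Set X) (_ : A ⊆ ⋃ n, t n) (_ : ∀ n, ediam (t n) ≤ r),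
      ∑' n, ⨆ _ : (t n).Nonempty, ediam (t n) ^ τ) _ (ENNReal.ofReal_pos.2 hε)).trans_eq hA
  have h2 := h1.trans_lt (ENNReal.ofReal_pos.2 hε)
  simp only [iInf_lt_iff] at h2
  obtain ⟨S, hAS, hS, hsum⟩ := h2
  -- Positive lower cut-offs for the radii with `∑ e k ^ τ ≤ ε`. They are needed because a set of
  -- diameter zero must still be thickened before its slab is divided into cells.
  set e : ℕ → ℝ := fun k => min ε ((ε / 2 / 2 ^ k) ^ (1 / τ))
  have he : ∀ k, 0 < e k := fun k => by positivity
  have heτ : ∀ k, e k ^ τ ≤ ε / 2 / 2 ^ k := by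
    intro k
    calc e k ^ τ ≤ ((ε / 2 / 2 ^ k) ^ (1 / τ)) ^ τ := by
          gcongr
          exact min_le_right _ _
      _ = ε / 2 / 2 ^ k := by
          rw [← Real.rpow_mul (by positivity), one_div_mul_cancel hτ.ne', Real.rpow_one]
  have hfin : ∀ k, ediam (S k) ≠ ⊤ := fun k => ne_top_of_le_ne_top ENNReal.ofReal_ne_top (hS k)
  refine ⟨S, fun k => max (ediam (S k)).toReal (e k), fun k => lt_max_of_lt_right (he k),
    fun k => max_le (ENNReal.toReal_le_of_le_ofReal hε.le (hS k)) (min_le_left _ _), hAS,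
    fun k => ?_, ?_⟩
  · rw [← ENNReal.ofReal_toReal (hfin k)]
    exact ENNReal.ofReal_le_ofReal (le_max_left _ _)
  · calc ∑' k, ENNReal.ofReal (max (ediam (S k)).toReal (e k) ^ τ)
        ≤ ∑' k, ((⨆ _ : (S k).Nonempty, ediam (S k) ^ τ) + ENNReal.ofReal (ε / 2 / 2 ^ k)) := by
          refine ENNReal.tsum_le_tsum fun k => ?_
          rcases le_total (ediam (S k)).toReal (e k) with h | h
          · rw [max_eq_right h]
            exact (ENNReal.ofReal_le_ofReal (heτ k)).trans le_add_self
          · rw [max_eq_left h, ← ENNReal.ofReal_rpow_of_nonneg ENNReal.toReal_nonneg hτ.le,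
              ENNReal.ofReal_toReal (hfin k)]
            refine le_trans ?_ le_self_add
            rcases (S k).eq_empty_or_nonempty with h0 | h0
            · simp [h0, hτ]
            · simp [h0]
      _ ≤ ENNReal.ofReal ε + ENNReal.ofReal ε := by
          rw [ENNReal.tsum_add]
          refine add_le_add hsum.le (le_of_eq ?_)
          rw [← ENNReal.ofReal_tsum_of_nonneg (fun k => by positivity) (summable_geometric_two' ε),
            tsum_geometric_two']
      _ = ENNReal.ofReal (2 * ε) := by
          rw [← ENNReal.ofReal_add hε.le hε.le, two_mul]

variable {d : ℕ}

/-- A bounded slab of width `r` is covered by `O(r ^ (1 - d))` sets of diameter `O(r)`. -/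
lemma exists_cover_slab (hd : 1 ≤ d) {e : EuclideanSpace ℝ (Fin d)} (he : ‖e‖ = 1) {R r : ℝ}
    (hR : 0 ≤ R) (hr : 0 < r) (hr1 : r ≤ 1) {S : Set ℝ} (hS : ediam S ≤ ENNReal.ofReal r) :
    ∃ (m : ℕ) (T : Fin m → Set (EuclideanSpace ℝ (Fin d))),
      (m : ℝ) ≤ (2 * R + 2) ^ (d - 1) * r ^ (-((d : ℝ) - 1)) ∧
      (∀ i, ediam (T i) ≤ ENNReal.ofReal (d * r)) ∧
      closedBall 0 R ∩ (fun x => ⟪x, e⟫) ⁻¹' S ⊆ ⋃ i, T i := by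
  let i₀ : Fin d := ⟨0, hd⟩
  obtain ⟨b, hb⟩ := Orthonormal.exists_orthonormalBasis_extension_of_card_eq (𝕜 := ℝ)
    (E := EuclideanSpace ℝ (Fin d)) (ι := Fin d) (by simp) (v := fun _ => e) (s := {i₀}) (by
      rw [orthonormal_iff_ite]
      rintro ⟨i, rfl⟩ ⟨j, rfl⟩
      simp [he])
  have hb0 : b i₀ = e := hb i₀ rfl
  -- Number of grid cells of side `r` along one axis; the extra cell receives the right endpoint.
  set M : ℕ := ⌈2 * R / r⌉₊ + 1 with hM
  have hMle : (M : ℝ) ≤ (2 * R + 2) * r⁻¹ := by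
    rw [hM]
    push_cast
    have h1 := Nat.ceil_lt_add_one (show 0 ≤ 2 * R / r by positivity)
    have h2 : 1 ≤ r⁻¹ := (one_le_inv₀ hr).2 hr1
    have h3 : 2 * R / r = 2 * R * r⁻¹ := div_eq_mul_inv _ _
    nlinarith
  let ι := {i : Fin d // i ≠ i₀} → Fin M
  have hcard : Fintype.card ι = M ^ (d - 1) := by
    simp [ι, Fintype.card_subtype_compl]
  let T : ι → Set (EuclideanSpace ℝ (Fin d)) := fun j =>
    {x | ⟪x, e⟫ ∈ S ∧ ∀ i : {i : Fin d // i ≠ i₀},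
      (j i : ℕ) * r ≤ b.repr x i + R ∧ b.repr x i + R ≤ ((j i : ℕ) + 1) * r}
  let φ : ι ≃ Fin (M ^ (d - 1)) := Fintype.equivFinOfCardEq hcard
  refine ⟨M ^ (d - 1), fun k => T (φ.symm k), ?_, ?_, ?_⟩
  · have : r ^ (-((d : ℝ) - 1)) = (r⁻¹) ^ (d - 1) := by
      rw [← Nat.cast_one, ← Nat.cast_sub hd, Real.rpow_neg hr.le, Real.rpow_natCast, inv_pow]
    rw [this, ← mul_pow]
    push_cast
    gcongr
  · intro k
    refine ediam_le fun x hx y hy => ?_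
    rw [edist_dist]
    apply ENNReal.ofReal_le_ofReal
    have hco : ∀ i, |b.repr (x - y) i| ≤ r := by
      intro i
      by_cases h : i = i₀
      · rw [b.repr_apply_apply, h, hb0, real_inner_comm, inner_sub_left, ← Real.dist_eq,
          ← ENNReal.ofReal_le_ofReal_iff hr.le, ← edist_dist]
        exact (edist_le_ediam_of_mem hx.1 hy.1).trans hS
      · have h1 := hx.2 ⟨i, h⟩
        have h2 := hy.2 ⟨i, h⟩
        have h3 : b.repr (x - y) i = b.repr x i - b.repr y i := by simp
        rw [h3, abs_le]
        constructor <;> linarith [h1.1, h1.2, h2.1, h2.2]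
    rw [dist_eq_norm, ← b.sum_repr (x - y)]
    refine (norm_sum_le _ _).trans ?_
    refine (Finset.sum_le_card_nsmul _ _ r fun i _ => ?_).trans_eq (by simp)
    rw [norm_smul, b.orthonormal.1 i, mul_one]
    exact hco i
  · rintro x ⟨hx, hxS⟩
    have hxc : ∀ i, |b.repr x i| ≤ R := by
      intro i
      rw [b.repr_apply_apply]
      refine (abs_real_inner_le_norm _ _).trans ?_
      rw [b.orthonormal.1 i, one_mul]
      simpa using hx
    have hlt : ∀ i, ⌊(b.repr x i + R) / r⌋₊ < M := by
      intro i
      have h1 := (abs_le.1 (hxc i))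
      rw [hM, Nat.lt_succ_iff]
      refine (Nat.floor_le_ceil _).trans (Nat.ceil_mono ?_)
      gcongr
      linarith [h1.2]
    rw [mem_iUnion]
    refine ⟨φ fun i => ⟨_, hlt i⟩, ?_⟩
    rw [Equiv.symm_apply_apply]
    refine ⟨hxS, fun i => ?_⟩
    have h1 := (abs_le.1 (hxc i))
    have h0 : 0 ≤ (b.repr x i + R) / r := div_nonneg (by linarith [h1.1]) hr.le
    constructor
    · rw [← le_div_iff₀ hr]
      exact Nat.floor_le h0
    · rw [← div_le_iff₀ hr]
      exact (Nat.lt_floor_add_one _).le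

/-- A bounded set whose projection to a direction is `τ`-null is `(d - 1 + τ)`-null. -/
lemma hausdorffMeasure_eq_zero_of_inner_image (hd : 1 ≤ d) {e : EuclideanSpace ℝ (Fin d)}
    (he : ‖e‖ = 1) {Γ : Set (EuclideanSpace ℝ (Fin d))} (hΓ : Bornology.IsBounded Γ) {τ : ℝ}
    (hτ : 0 < τ) (h : Measure.hausdorffMeasure τ ((fun x => ⟪x, e⟫) '' Γ) = 0) :
    Measure.hausdorffMeasure ((d : ℝ) - 1 + τ) Γ = 0 := by
  obtain ⟨R₀, hR₀⟩ := hΓ.subset_closedBall (0 : EuclideanSpace ℝ (Fin d))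
  set R := max R₀ 0
  have hR : Γ ⊆ closedBall 0 R := hR₀.trans (closedBall_subset_closedBall (le_max_left _ _))
  have hR0 : 0 ≤ R := le_max_right _ _
  have hdR : (1 : ℝ) ≤ d := by exact_mod_cast hd
  set β : ℝ := (d : ℝ) - 1 + τ with hβ
  have hβ0 : 0 < β := by linarith
  set ε : ℕ → ℝ := fun n => 1 / ((n : ℝ) + 1)
  have hε : ∀ n, 0 < ε n := fun n => by positivity
  have hε1 : ∀ n, ε n ≤ 1 := fun n => by
    simp only [ε]
    rw [div_le_one (by positivity)]
    linarith [(n.cast_nonneg : (0 : ℝ) ≤ n)]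
  have hε0 : Tendsto ε atTop (𝓝 0) := tendsto_one_div_add_atTop_nhds_zero_nat
  choose S r hr0 hrε hcov hdiam hsum using fun n =>
    exists_cover_of_hausdorffMeasure_eq_zero hτ h (hε n)
  choose m T hm hT hTcov using fun n k =>
    exists_cover_slab hd he hR0 (hr0 n k) ((hrε n k).trans (hε1 n)) (hdiam n k)
  -- A slab of width `r` costs `r ^ (-(d - 1))` cells, each contributing `(d * r) ^ β`, in total `C
  -- * r ^ τ`.
  set C : ℝ := (2 * R + 2) ^ (d - 1) * (d : ℝ) ^ β
  have hC : 0 ≤ C := by positivity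
  have key := Measure.hausdorffMeasure_le_liminf_tsum β Γ (l := atTop)
    (ι := fun n => Σ k, Fin (m n k)) (fun n => ENNReal.ofReal (d * ε n)) (by
      have := ENNReal.tendsto_ofReal (hε0.const_mul (d : ℝ))
      simpa using this) (fun n p => T n p.1 p.2)
    (Eventually.of_forall fun n p => (hT n p.1 p.2).trans (ENNReal.ofReal_le_ofReal
      (by gcongr; exact hrε n p.1)))
    (Eventually.of_forall fun n x hx => by
      obtain ⟨k, hk⟩ := mem_iUnion.1 (hcov n (mem_image_of_mem _ hx))
      obtain ⟨i, hi⟩ := mem_iUnion.1 (hTcov n k ⟨hR hx, hk⟩)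
      exact mem_iUnion.2 ⟨⟨k, i⟩, hi⟩)
  have hbound : ∀ n, ∑' p : Σ k, Fin (m n k), ediam (T n p.1 p.2) ^ β ≤
      ENNReal.ofReal (C * (2 * ε n)) := by
    intro n
    rw [ENNReal.tsum_sigma']
    calc ∑' k, ∑' i, ediam (T n k i) ^ β
        ≤ ∑' k, ENNReal.ofReal C * ENNReal.ofReal (r n k ^ τ) := by
          refine ENNReal.tsum_le_tsum fun k => ?_
          have hr := hr0 n k
          calc ∑' i, ediam (T n k i) ^ β ≤ ∑' _ : Fin (m n k), ENNReal.ofReal ((d * r n k) ^ β) := by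
                refine ENNReal.tsum_le_tsum fun i => ?_
                rw [← ENNReal.ofReal_rpow_of_nonneg (by positivity) hβ0.le]
                exact ENNReal.rpow_le_rpow (hT n k i) hβ0.le
            _ = ENNReal.ofReal (m n k * (d * r n k) ^ β) := by
                rw [tsum_fintype, Finset.sum_const, Finset.card_univ, Fintype.card_fin,
                  nsmul_eq_mul, ENNReal.ofReal_mul (by positivity), ENNReal.ofReal_natCast]
            _ ≤ ENNReal.ofReal (C * r n k ^ τ) := by
                apply ENNReal.ofReal_le_ofReal
                calc (m n k : ℝ) * (d * r n k) ^ β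
                    ≤ ((2 * R + 2) ^ (d - 1) * r n k ^ (-((d : ℝ) - 1))) * (d * r n k) ^ β := by
                      gcongr
                      exact hm n k
                  _ = C * r n k ^ τ := by
                      rw [Real.mul_rpow (by positivity) hr.le]
                      have : r n k ^ τ = r n k ^ (-((d : ℝ) - 1)) * r n k ^ β := by
                        rw [← Real.rpow_add hr, hβ]
                        ring_nf
                      rw [this]
                      ring
            _ = _ := ENNReal.ofReal_mul hC
      _ = ENNReal.ofReal C * ∑' k, ENNReal.ofReal (r n k ^ τ) := ENNReal.tsum_mul_left
      _ ≤ ENNReal.ofReal C * ENNReal.ofReal (2 * ε n) := by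
          gcongr
          exact hsum n
      _ = _ := (ENNReal.ofReal_mul hC).symm
  have hlim : Tendsto (fun n => ENNReal.ofReal (C * (2 * ε n))) atTop (𝓝 0) := by
    have := ENNReal.tendsto_ofReal ((hε0.const_mul 2).const_mul C)
    simpa using this
  refine le_antisymm (key.trans ?_) zero_le
  rw [← hlim.liminf_eq]
  exact liminf_le_liminf (Eventually.of_forall hbound)

/-- Apply the null-set version at exponents decreasing to `τ`. It is used both to bound `dimH Γ`
above and, contrapositively, to bound the projections below. -/
lemma dimH_le_dimH_inner_image_add (hd : 1 ≤ d) {e : EuclideanSpace ℝ (Fin d)}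
    (he : ‖e‖ = 1) {Γ : Set (EuclideanSpace ℝ (Fin d))} (hΓ : Bornology.IsBounded Γ) {τ : ℝ}
    (hτ : 0 ≤ τ) (h : dimH ((fun x => ⟪x, e⟫) '' Γ) ≤ ENNReal.ofReal τ) :
    dimH Γ ≤ ENNReal.ofReal ((d : ℝ) - 1 + τ) := by
  have hdR : (1 : ℝ) ≤ d := by exact_mod_cast hd
  have key : ∀ n : ℕ, dimH Γ ≤ ENNReal.ofReal ((d : ℝ) - 1 + (τ + 1 / ((n : ℝ) + 1))) := by
    intro n
    have hn : 0 < 1 / ((n : ℝ) + 1) := by positivity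
    have h1 : Measure.hausdorffMeasure (τ + 1 / ((n : ℝ) + 1)) ((fun x => ⟪x, e⟫) '' Γ) = 0 := by
      have := hausdorffMeasure_of_dimH_lt (d := (τ + 1 / ((n : ℝ) + 1)).toNNReal)
        (h.trans_lt ((ENNReal.ofReal_lt_ofReal_iff (by linarith)).2 (by linarith)))
      rwa [Real.coe_toNNReal _ (by linarith)] at this
    have h2 := hausdorffMeasure_eq_zero_of_inner_image hd he hΓ (by linarith) h1
    refine dimH_le_of_hausdorffMeasure_ne_top
      (d := ((d : ℝ) - 1 + (τ + 1 / ((n : ℝ) + 1))).toNNReal) ?_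
    rw [Real.coe_toNNReal _ (by linarith), h2]
    exact ENNReal.zero_ne_top
  have hlim : Tendsto (fun n : ℕ => ENNReal.ofReal ((d : ℝ) - 1 + (τ + 1 / ((n : ℝ) + 1)))) atTop
      (𝓝 (ENNReal.ofReal ((d : ℝ) - 1 + (τ + 0)))) :=
    ENNReal.tendsto_ofReal ((tendsto_one_div_add_atTop_nhds_zero_nat.const_add τ).const_add _)
  rw [add_zero] at hlim
  exact ge_of_tendsto' hlim key

/-- A bounded set of reals that lies, for a sequence of frequencies `N`, in the
`η / N`-neighbourhood of `N⁻¹ ℤ` is `τ`-null if `N * (η / N) ^ τ → 0`. -/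
lemma hausdorffMeasure_eq_zero_of_near_lattice {A : Set ℝ} {R : ℝ} (hR : 0 ≤ R)
    (hA : ∀ u ∈ A, |u| ≤ R) {τ : ℝ} (hτ : 0 ≤ τ) {N η : ℕ → ℝ} (hN : ∀ k, 1 ≤ N k)
    (hη : ∀ k, 0 ≤ η k) (hη1 : ∀ k, η k ≤ 1) (hη0 : Tendsto η atTop (𝓝 0))
    (hnear : ∀ k, ∀ u ∈ A, ‖((N k * u : ℝ) : UnitAddCircle)‖ ≤ η k)
    (hlim : Tendsto (fun k => N k * (η k / N k) ^ τ) atTop (𝓝 0)) :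
    Measure.hausdorffMeasure τ A = 0 := by
  set T : ℕ → ℤ → Set ℝ := fun k z => Icc ((z - η k) / N k) ((z + η k) / N k)
  -- As `|N k * u| ≤ N k * R` and `η k ≤ 1`, the nearest integer lies in `[-M k, M k]`; the number
  -- of these integers is at most `2 * N k * R + 5 ≤ (2 * R + 5) * N k`.
  set M : ℕ → ℤ := fun k => ⌈N k * R⌉ + 1
  have hdiam : ∀ k z, ediam (T k z) = ENNReal.ofReal (2 * (η k / N k)) := by
    intro k z
    rw [Real.ediam_Icc]
    congr 1
    ring
  have key := Measure.hausdorffMeasure_le_liminf_tsum τ A (l := atTop)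
    (ι := fun k => (Finset.Icc (-M k) (M k))) (fun k => ENNReal.ofReal (2 * (η k / N k))) (by
      have h1 : Tendsto (fun k => 2 * (η k / N k)) atTop (𝓝 0) := by
        have h2 := hη0.const_mul 2
        rw [mul_zero] at h2
        refine squeeze_zero (fun k => ?_) (fun k => ?_) h2
        · have := hN k; have := hη k; positivity
        · have := div_le_self (hη k) (hN k)
          linarith
      simpa using ENNReal.tendsto_ofReal h1) (fun k z => T k z)
    (Eventually.of_forall fun k z => (hdiam k z).le)
    (Eventually.of_forall fun k u hu => by
      have hNk : 0 < N k := by linarith [hN k]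
      have h1 := hnear k u hu
      rw [UnitAddCircle.norm_eq, abs_le] at h1
      have h2 : |N k * u| ≤ N k * R := by
        rw [abs_mul, abs_of_pos hNk]
        gcongr
        exact hA u hu
      rw [abs_le] at h2
      have h3 := Int.le_ceil (N k * R)
      have h4 := hη1 k
      refine mem_iUnion.2 ⟨⟨round (N k * u), ?_⟩, ?_⟩
      · rw [Finset.mem_Icc, ← Int.cast_le (R := ℝ), ← Int.cast_le (R := ℝ)]
        simp only [M]
        push_cast
        constructor <;> linarith
      · simp only [T]
        rw [mem_Icc, div_le_iff₀ hNk, le_div_iff₀ hNk]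
        constructor <;> linarith)
  set C : ℝ := (2 * R + 5) * 2 ^ τ
  have hbound : ∀ k, ∑' z : Finset.Icc (-M k) (M k), ediam (T k z) ^ τ ≤
      ENNReal.ofReal (C * (N k * (η k / N k) ^ τ)) := by
    intro k
    have hNk : 1 ≤ N k := hN k
    have hηN : 0 ≤ η k / N k := div_nonneg (hη k) (by linarith)
    simp only [hdiam]
    rw [tsum_fintype, Finset.sum_const, Finset.card_univ, Fintype.card_coe, Int.card_Icc,
      nsmul_eq_mul, ENNReal.ofReal_rpow_of_nonneg (by positivity) hτ, ← ENNReal.ofReal_natCast,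
      ← ENNReal.ofReal_mul (by positivity)]
    apply ENNReal.ofReal_le_ofReal
    rw [Real.mul_rpow (by norm_num) hηN]
    have h0 : 0 ≤ ⌈N k * R⌉ := Int.ceil_nonneg (by positivity)
    have h1 : ((M k + 1 - -M k).toNat : ℝ) ≤ (2 * R + 5) * N k := by
      have h2 : (((M k + 1 - -M k).toNat : ℤ) : ℝ) = ((M k + 1 - -M k : ℤ) : ℝ) := by
        rw [Int.toNat_of_nonneg (by simp only [M]; omega)]
      rw [Int.cast_natCast] at h2
      rw [h2]
      simp only [M]
      push_cast
      have h3 := Int.ceil_lt_add_one (N k * R)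
      nlinarith
    calc ((M k + 1 - -M k).toNat : ℝ) * (2 ^ τ * (η k / N k) ^ τ)
        ≤ ((2 * R + 5) * N k) * (2 ^ τ * (η k / N k) ^ τ) := by gcongr
      _ = _ := by ring
  have hlim' : Tendsto (fun k => ENNReal.ofReal (C * (N k * (η k / N k) ^ τ))) atTop (𝓝 0) := by
    simpa using ENNReal.tendsto_ofReal (hlim.const_mul C)
  refine le_antisymm (key.trans ?_) zero_le
  rw [← hlim'.liminf_eq]
  exact liminf_le_liminf (Eventually.of_forall hbound)

end Covering

/-! ### Projections onto lines as inner products -/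

section Lines

variable {d : ℕ}

/-- In a suitable isometric parametrization of the line, the orthogonal projection onto it is the
inner product with a unit vector. -/
lemma EuclLine.exists_unit_isometry (ℓ : EuclLine d) :
    ∃ (e : EuclideanSpace ℝ (Fin d)) (ι : ℝ → EuclideanSpace ℝ (Fin d)),
      ‖e‖ = 1 ∧ Isometry ι ∧ ∀ x, ℓ.proj x = ι ⟪x, e⟫ := by
  obtain ⟨⟨p, hp⟩, hdir⟩ := ℓ.2
  obtain ⟨w, hw, hspan⟩ := finrank_eq_one_iff'.1 hdir
  set e : EuclideanSpace ℝ (Fin d) := ‖(w : EuclideanSpace ℝ (Fin d))‖⁻¹ • w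
  have hw0 : (w : EuclideanSpace ℝ (Fin d)) ≠ 0 := by simpa using hw
  have he : ‖e‖ = 1 := by
    simp only [e]
    rw [norm_smul, norm_inv, norm_norm, inv_mul_cancel₀ (norm_ne_zero_iff.2 hw0)]
  have hed : e ∈ ℓ.1.direction := Submodule.smul_mem _ _ w.2
  have hmem : ∀ y ∈ ℓ.1.direction, ∃ c : ℝ, y = c • e := by
    intro y hy
    obtain ⟨c, hc⟩ := hspan ⟨y, hy⟩
    refine ⟨c * ‖(w : EuclideanSpace ℝ (Fin d))‖, ?_⟩
    have hc' : c • (w : EuclideanSpace ℝ (Fin d)) = y := congrArg Subtype.val hc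
    simp only [e]
    rw [smul_smul, mul_assoc, mul_inv_cancel₀ (norm_ne_zero_iff.2 hw0), mul_one, hc']
  refine ⟨e, fun u => p + (u - ⟪p, e⟫) • e, he, ?_, ?_⟩
  · refine Isometry.of_dist_eq fun u u' => ?_
    rw [dist_eq_norm, add_sub_add_left_eq_sub, ← sub_smul, norm_smul, he, mul_one,
      sub_sub_sub_cancel_right, Real.norm_eq_abs, Real.dist_eq]
  · intro x
    unfold EuclLine.proj
    rw [EuclideanGeometry.coe_orthogonalProjection_eq_iff_mem]
    constructor
    · beta_reduce
      rw [add_comm]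
      exact AffineSubspace.vadd_mem_of_mem_direction (Submodule.smul_mem _ _ hed) hp
    · rw [Submodule.mem_orthogonal]
      intro y hy
      obtain ⟨c, rfl⟩ := hmem y hy
      rw [vsub_eq_sub, real_inner_smul_left, inner_sub_right, inner_add_right,
        real_inner_smul_right, real_inner_self_eq_norm_sq, he, real_inner_comm x, real_inner_comm p]
      ring

lemma EuclLine.nonempty_of_pos (hd : 1 ≤ d) : Nonempty (EuclLine d) := by
  let i₀ : Fin d := ⟨0, hd⟩
  have hne : (EuclideanSpace.single i₀ (1 : ℝ)) ≠ 0 := by simp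
  refine ⟨⟨AffineSubspace.mk' 0 (Submodule.span ℝ {EuclideanSpace.single i₀ (1 : ℝ)}),
    AffineSubspace.mk'_nonempty _ _, ?_⟩⟩
  rw [AffineSubspace.direction_mk', finrank_span_singleton hne]

end Lines

/-! ### The iterated slab construction -/

section Construction

variable {d : ℕ}

/-- A normalized cone over the ball of radius `1 / 2` about the centre of the cube. -/
lemma exists_testDensity_unitCube (d : ℕ) :
    ∃ f : EuclideanSpace ℝ (Fin d) → ℝ, IsTestDensity f ∧ tsupport f ⊆ euclUnitCube d := by
  set c : EuclideanSpace ℝ (Fin d) := WithLp.toLp 2 fun _ => (1 / 2 : ℝ)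
  set h : EuclideanSpace ℝ (Fin d) → ℝ := fun x => max 0 (1 / 2 - ‖x - c‖)
  have hc : Continuous h := by fun_prop
  have h0 : ∀ x, 0 ≤ h x := fun x => le_max_left _ _
  have hsupp : ∀ x, x ∉ closedBall c (1 / 2) → h x = 0 := by
    intro x hx
    rw [mem_closedBall, dist_eq_norm, not_le] at hx
    exact max_eq_left (by linarith)
  have hcs : HasCompactSupport h := HasCompactSupport.intro (isCompact_closedBall c (1 / 2)) hsupp
  have hpos : 0 < ∫ x, h x := by
    refine hc.integral_pos_of_hasCompactSupport_nonneg_nonzero hcs h0 (x := c) ?_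
    simp [h]
  refine ⟨fun x => h x / ∫ y, h y, ⟨hc.div_const _, ?_, fun x => div_nonneg (h0 x) hpos.le, ?_⟩, ?_⟩
  · refine hcs.mono fun x hx => ?_
    contrapose! hx
    simp only [Function.mem_support, ne_eq, not_not] at hx
    simp [hx]
  · rw [integral_div, div_self hpos.ne']
  · refine (closure_minimal (t := closedBall c (1 / 2)) ?_ isClosed_closedBall).trans ?_
    · intro x hx
      by_contra hx'
      exact hx (by simp [hsupp x hx'])
    · intro x hx i
      have h1 : ‖(x - c) i‖ ≤ 1 / 2 := (PiLp.norm_apply_le (x - c) i).trans (by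
        rw [← dist_eq_norm]; exact hx)
      have h2 : (x - c) i = x i - 1 / 2 := by simp [c]
      rw [h2, Real.norm_eq_abs, abs_le] at h1
      constructor <;> linarith [h1.1, h1.2]

lemma tendsto_smul_sub_cobounded {V : Type*} [NormedAddCommGroup V] [NormedSpace ℝ V] {e : V}
    (he : ‖e‖ = 1) (c : V) :
    Tendsto (fun N : ℝ => N • e - c) atTop (Bornology.cobounded V) := by
  rw [← tendsto_norm_atTop_iff_cobounded]
  refine tendsto_atTop_mono' _ ?_ (tendsto_atTop_add_const_right _ (-‖c‖) tendsto_id)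
  filter_upwards [eventually_ge_atTop 0] with N hN
  have := norm_sub_norm_le (N • e) c
  rw [norm_smul, he, mul_one, Real.norm_of_nonneg hN] at this
  simp only [id]
  linarith

/-- The slab condition is closed, so it passes from the support to its closure and thus to every
point of the final intersection. -/
lemma tsupport_slabDensity_subset {V : Type*} [NormedAddCommGroup V] [InnerProductSpace ℝ V]
    [FiniteDimensional ℝ V] [MeasurableSpace V] [BorelSpace V] {α : ℝ} {f : V → ℝ} {v : V}
    (hv : 0 < ‖v‖ ^ (1 - 1 / α)) :
    tsupport (slabDensity α f v) ⊆
      tsupport f ∩ {x | ‖((⟪x, v⟫ : ℝ) : UnitAddCircle)‖ ≤ ‖v‖ ^ (1 - 1 / α)} := by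
  have hcont : Continuous fun u : ℝ => (u : UnitAddCircle) := AddCircle.continuous_mk' 1
  refine closure_minimal (fun x hx => ⟨subset_tsupport _ ?_, ?_⟩)
    ((isClosed_tsupport f).inter (isClosed_le (by fun_prop) continuous_const))
  · intro h
    exact hx (by simp [slabDensity, h])
  · refine norm_coe_le_of_periodicBump_ne_zero hv fun h => ?_
    exact hx (by rw [slabDensity, h, mul_zero, zero_div])

/-- One step of the construction. -/
lemma exists_slab_frequency (hd : 1 ≤ d) {f : EuclideanSpace ℝ (Fin d) → ℝ}
    (hf : IsTestDensity f) {e : EuclideanSpace ℝ (Fin d)} (he : ‖e‖ = 1)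
    (c : EuclideanSpace ℝ (Fin d)) {α τ : ℝ} (hα : 0 < α) (hα1 : α < 1) (hτ : α < τ)
    {s : ℕ → ℝ} (hs : ∀ m, 0 ≤ s m) (n : ℕ) (hsα : ∀ m ≤ n, s m < d - 1 + α) :
    ∃ N : ℝ, 0 ≤ N ∧ IsTestDensity (slabDensity α f (N • e - c)) ∧ 1 ≤ ‖N • e - c‖ ∧
      ‖N • e - c‖ ^ (1 - 1 / α) ≤ 1 / ((n : ℝ) + 1) ∧
      ‖N • e - c‖ ^ (1 - τ / α) ≤ 1 / ((n : ℝ) + 1) ∧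
      ∀ m ≤ n, rieszEnergy (s m) (densityMeasure (slabDensity α f (N • e - c))) ≤
        rieszEnergy (s m) (densityMeasure f) + ENNReal.ofReal ((1 / 2) ^ n) := by
  have hn : (0 : ℝ) < 1 / ((n : ℝ) + 1) := by positivity
  have hnorm := tendsto_norm_cobounded_atTop (E := EuclideanSpace ℝ (Fin d))
  have hτα : 0 < τ / α - 1 := by rw [sub_pos, lt_div_iff₀ hα]; linarith
  -- Every requirement holds for all sufficiently large `v`, so direction and offset can be
  -- prescribed and only `N` is left to choose.
  have hev : ∀ᶠ v in Bornology.cobounded (EuclideanSpace ℝ (Fin d)),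
      IsTestDensity (slabDensity α f v) ∧ 1 ≤ ‖v‖ ∧ ‖v‖ ^ (1 - 1 / α) ≤ 1 / ((n : ℝ) + 1) ∧
      ‖v‖ ^ (1 - τ / α) ≤ 1 / ((n : ℝ) + 1) ∧
      ∀ m ≤ n, rieszEnergy (s m) (densityMeasure (slabDensity α f v)) ≤
        rieszEnergy (s m) (densityMeasure f) + ENNReal.ofReal ((1 / 2) ^ n) := by
    have h1 := (tendsto_slabMass hf hα hα1).eventually_const_lt (show (0 : ℝ) < 1 by norm_num)
    -- With `η = ‖v‖ ^ (1 - 1 / α)` one has `‖v‖ * (η / ‖v‖) ^ τ = ‖v‖ ^ (1 - τ / α)`, the cost of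
    -- covering a neighbourhood of the lattice.
    have h2 := ((tendsto_rpow_neg_atTop hτα).comp hnorm).eventually_le_const hn
    have h3 : ∀ᶠ v in Bornology.cobounded (EuclideanSpace ℝ (Fin d)), ∀ m ∈ Finset.range (n + 1),
        rieszEnergy (s m) (densityMeasure (slabDensity α f v)) ≤
          rieszEnergy (s m) (densityMeasure f) + ENNReal.ofReal ((1 / 2) ^ n) := by
      rw [Filter.eventually_all_finset]
      intro m hm
      exact eventually_rieszEnergy_slabDensity_le hd hf hα hα1 (hs m)
        (hsα m (Nat.lt_succ_iff.1 (Finset.mem_range.1 hm))) (by positivity)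
    filter_upwards [h1, h2, h3, hnorm.eventually_ge_atTop 1, eventually_rpow_half_width hα hα1 hn]
      with v hv1 hv2 hv3 hv4 hv5
    refine ⟨hf.slabDensity hv1, hv4, hv5.2, by simpa using hv2, fun m hm => ?_⟩
    exact hv3 m (Finset.mem_range.2 (Nat.lt_succ_iff.2 hm))
  obtain ⟨N, hN, hN0⟩ := (((tendsto_smul_sub_cobounded he c).eventually hev).and
    (eventually_ge_atTop 0)).exists
  exact ⟨N, hN0, hN⟩

/-- The iterated slab construction: a compact set in the unit cube carrying a measure of finite
energies, which projects injectively onto small sets in countably many directions. -/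
theorem exists_isCompact_small_inner_image (hd : 1 ≤ d) {ι : Type*} [Countable ι] [Nonempty ι]
    {e : ι → EuclideanSpace ℝ (Fin d)} (he : ∀ i, ‖e i‖ = 1) {s α τ : ℕ → ℝ}
    (hs : ∀ m, 0 ≤ s m) (hα : ∀ n, 0 < α n) (hα1 : ∀ n, α n < 1) (hτ : ∀ n, α n < τ n)
    (hsα : ∀ m n, m ≤ n → s m < d - 1 + α n) :
    ∃ (Γ : Set (EuclideanSpace ℝ (Fin d))) (μ : Measure (EuclideanSpace ℝ (Fin d))),
      IsCompact Γ ∧ Γ ⊆ euclUnitCube d ∧ IsProbabilityMeasure μ ∧ μ Γᶜ = 0 ∧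
      (∀ m, rieszEnergy (s m) μ < ⊤) ∧ (∀ i, InjOn (fun x => ⟪x, e i⟫) Γ) ∧
      ∀ (i : ι) (σ : ℝ), (∀ᶠ n in atTop, τ n ≤ σ) →
        Measure.hausdorffMeasure σ ((fun x => ⟪x, e i⟫) '' Γ) = 0 := by
  obtain ⟨φ, hφ⟩ := exists_surjective_nat (ι × Option (Fin d))
  -- `none` leaves the frequency parallel to `e i`, for small projections; `some j` tilts it to
  -- separate the `j`-th coordinates.
  let c : Option (Fin d) → EuclideanSpace ℝ (Fin d) := fun o =>
    o.elim 0 fun j => (1 / 2 : ℝ) • EuclideanSpace.single j 1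
  -- Through `unpair` every direction with every offset occurs at infinitely many stages.
  let dir : ℕ → ι × Option (Fin d) := fun n => φ n.unpair.1
  obtain ⟨f₀, hf₀, hf₀c⟩ := exists_testDensity_unitCube d
  choose! N hN0 hN hN1 hη hτN hE using
    fun (n : ℕ) (f : EuclideanSpace ℝ (Fin d) → ℝ) (hf : IsTestDensity f) =>
      exists_slab_frequency hd hf (he (dir n).1) (c (dir n).2) (hα n) (hα1 n) (hτ n) hs n
        (fun m hm => hsα m n hm)
  let w : ℕ → (EuclideanSpace ℝ (Fin d) → ℝ) → EuclideanSpace ℝ (Fin d) := fun n f =>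
    N n f • e (dir n).1 - c (dir n).2
  let f : ℕ → EuclideanSpace ℝ (Fin d) → ℝ := fun n =>
    Nat.rec f₀ (fun n g => slabDensity (α n) g (w n g)) n
  have hf : ∀ n, IsTestDensity (f n) := by
    intro n
    induction n with
    | zero => exact hf₀
    | succ n ih => exact hN n (f n) ih
  let v : ℕ → EuclideanSpace ℝ (Fin d) := fun n => w n (f n)
  have hv1 : ∀ n, 1 ≤ ‖v n‖ := fun n => hN1 n (f n) (hf n)
  have hvη : ∀ n, ‖v n‖ ^ (1 - 1 / α n) ≤ 1 / ((n : ℝ) + 1) := fun n => hη n (f n) (hf n)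
  have hvτ : ∀ n, ‖v n‖ ^ (1 - τ n / α n) ≤ 1 / ((n : ℝ) + 1) := fun n => hτN n (f n) (hf n)
  have hη0 : ∀ n, 0 < ‖v n‖ ^ (1 - 1 / α n) := fun n => by
    have := hv1 n
    positivity
  have hsub : ∀ n, tsupport (f (n + 1)) ⊆ tsupport (f n) ∩
      {x | ‖((⟪x, v n⟫ : ℝ) : UnitAddCircle)‖ ≤ ‖v n‖ ^ (1 - 1 / α n)} := fun n =>
    tsupport_slabDensity_subset (hη0 n)
  have hanti : Antitone fun n => tsupport (f n) :=
    antitone_nat_of_succ_le fun n => (hsub n).trans inter_subset_left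
  have hcomp : ∀ n, IsCompact (tsupport (f n)) := fun n => (hf n).hasCompactSupport
  obtain ⟨μ, hμ, hμΓ, hμE⟩ := exists_probabilityMeasure_iInter hcomp hanti
    (fun n => densityProbabilityMeasure (f n)) (fun n => by
      rw [coe_densityProbabilityMeasure (hf n), densityMeasure,
        withDensity_apply _ (isClosed_tsupport _).measurableSet.compl]
      refine setLIntegral_eq_zero (isClosed_tsupport _).measurableSet.compl fun x hx => ?_
      simp [image_eq_zero_of_notMem_tsupport hx])
  set Γ := ⋂ n, tsupport (f n)
  have hΓ0 : Γ ⊆ euclUnitCube d := (iInter_subset _ 0).trans hf₀c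
  have hΓ : IsCompact Γ := (hcomp 0).of_isClosed_subset
    (isClosed_iInter fun n => isClosed_tsupport _) (iInter_subset _ 0)
  have hmem : ∀ x ∈ Γ, ∀ n, ‖((⟪x, v n⟫ : ℝ) : UnitAddCircle)‖ ≤ ‖v n‖ ^ (1 - 1 / α n) :=
    fun x hx n => (hsub n (mem_iInter.1 hx (n + 1))).2
  refine ⟨Γ, μ, hΓ, hΓ0, hμ, hμΓ, fun m => ?_, fun i x hx y hy hxy => ?_, fun i σ hσ => ?_⟩
  -- The `s m`-energy is controlled only from stage `m` on, where it is finite because `f m` is a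
  -- test density; later increments sum to at most `2`.
  · have hstep : ∀ n, rieszEnergy (s m) (densityMeasure (f (m + n))) ≤
        rieszEnergy (s m) (densityMeasure (f m)) +
          ENNReal.ofReal (∑ k ∈ Finset.range n, (1 / 2 : ℝ) ^ k) := by
      intro n
      induction n with
      | zero => simp
      | succ n ih =>
        refine (hE (m + n) (f (m + n)) (hf (m + n)) m (Nat.le_add_right m n)).trans ?_
        rw [Finset.sum_range_succ, ENNReal.ofReal_add (by positivity) (by positivity), ← add_assoc]
        refine add_le_add ih (ENNReal.ofReal_le_ofReal ?_)
        exact pow_le_pow_of_le_one (by norm_num) (by norm_num) (Nat.le_add_left n m)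
    refine (hμE (s m) (rieszEnergy (s m) (densityMeasure (f m)) + ENNReal.ofReal 2) m
      fun n hn => ?_).trans_lt (ENNReal.add_lt_top.2 ⟨?_, ENNReal.ofReal_lt_top⟩)
    · rw [coe_densityProbabilityMeasure (hf n), ← Nat.add_sub_of_le hn]
      refine (hstep _).trans ?_
      gcongr
      exact sum_geometric_two_le _
    · exact (hf m).rieszEnergy_lt_top (hs m) (by linarith [hsα m m le_rfl, hα1 m])
  · ext j
    obtain ⟨a, ha⟩ := hφ (i, some j)
    have hdir : ∀ k, dir (Nat.pair a k) = (i, some j) := fun k => by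
      simp only [dir, Nat.unpair_pair, ha]
    have hxj := hΓ0 hx j
    have hyj := hΓ0 hy j
    have key : ∀ k : ℕ, |x j - y j| ≤ 4 * (1 / ((k : ℝ) + 1)) := by
      intro k
      set n := Nat.pair a k with hn
      have hvn : v n = N n (f n) • e i - (1 / 2 : ℝ) • EuclideanSpace.single j 1 := by
        simp only [v, w, hn, hdir, c, Option.elim]
      have h1 : ⟪x, v n⟫ - ⟪y, v n⟫ = -((x j - y j) / 2) := by
        simp only [hvn, inner_sub_right, real_inner_smul_right, EuclideanSpace.inner_single_right]
        simp only at hxy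
        rw [hxy]
        simp
        ring
      -- The factor `1 / 2` in the offset matters here: within the unit cube the phase difference is
      -- at most half a period, so its norm on the circle is its absolute value.
      have h2 : ‖((-((x j - y j) / 2) : ℝ) : UnitAddCircle)‖ = |x j - y j| / 2 := by
        rw [(AddCircle.norm_coe_eq_abs_iff (p := (1 : ℝ)) one_ne_zero).2, abs_neg, abs_div, abs_two]
        rw [abs_neg, abs_div, abs_two, abs_one]
        have : |x j - y j| ≤ 1 := by
          rw [abs_le]
          constructor <;> linarith [hxj.1, hxj.2, hyj.1, hyj.2]
        linarith
      have h3 : ‖((-((x j - y j) / 2) : ℝ) : UnitAddCircle)‖ ≤ 2 * ‖v n‖ ^ (1 - 1 / α n) := by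
        rw [← h1, AddCircle.coe_sub]
        refine (norm_sub_le _ _).trans ?_
        linarith [hmem x hx n, hmem y hy n]
      have h4 : 1 / ((n : ℝ) + 1) ≤ 1 / ((k : ℝ) + 1) :=
        Nat.one_div_le_one_div (Nat.right_le_pair a k)
      linarith [hvη n]
    have hlim := (tendsto_one_div_add_atTop_nhds_zero_nat (𝕜 := ℝ)).const_mul 4
    rw [mul_zero] at hlim
    have := ge_of_tendsto' hlim key
    exact sub_eq_zero.1 (abs_nonpos_iff.1 this)
  · obtain ⟨a, ha⟩ := hφ (i, none)
    obtain ⟨k₀, hk₀⟩ := eventually_atTop.1 hσ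
    have hσ0 : 0 ≤ σ := by linarith [hk₀ k₀ le_rfl, hτ k₀, hα k₀]
    -- The shift by `k₀` keeps these stages in the range where `τ ≤ σ`.
    let n : ℕ → ℕ := fun k => Nat.pair a (k + k₀)
    have hnk : ∀ k, k + k₀ ≤ n k := fun k => Nat.right_le_pair a _
    have hvn : ∀ k, v (n k) = N (n k) (f (n k)) • e i := fun k => by
      have hdir : dir (n k) = (i, none) := by simp only [dir, n, Nat.unpair_pair, ha]
      simp only [v, w, hdir, c, Option.elim, sub_zero]
    have hNn : ∀ k, ‖v (n k)‖ = N (n k) (f (n k)) := fun k => by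
      rw [hvn, norm_smul, he, mul_one, Real.norm_of_nonneg (hN0 _ _ (hf _))]
    have hto : Tendsto (fun k : ℕ => 1 / ((n k : ℝ) + 1)) atTop (𝓝 0) :=
      tendsto_one_div_add_atTop_nhds_zero_nat.comp
        (tendsto_atTop_mono (fun k => (Nat.le_add_right _ _).trans (hnk k)) tendsto_id)
    obtain ⟨R, hR⟩ := hΓ.isBounded.subset_closedBall (0 : EuclideanSpace ℝ (Fin d))
    refine hausdorffMeasure_eq_zero_of_near_lattice (R := max R 0) (le_max_right _ _) ?_ hσ0
      (N := fun k => ‖v (n k)‖) (η := fun k => ‖v (n k)‖ ^ (1 - 1 / α (n k))) (fun k => hv1 _)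
      (fun k => (hη0 _).le) (fun k => (hvη _).trans ?_) ?_ ?_ ?_
    · rintro _ ⟨x, hx, rfl⟩
      refine (abs_real_inner_le_norm _ _).trans ?_
      rw [he, mul_one]
      exact le_max_of_le_left (by simpa using hR hx)
    · rw [div_le_one (by positivity)]
      linarith [((n k).cast_nonneg : (0 : ℝ) ≤ n k)]
    · exact squeeze_zero (fun k => (hη0 _).le) (fun k => hvη _) hto
    · rintro k _ ⟨x, hx, rfl⟩
      have := hmem x hx (n k)
      have hin : ⟪x, v (n k)⟫ = ‖v (n k)‖ * ⟪x, e i⟫ := by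
        rw [hNn, hvn, real_inner_smul_right]
      rwa [hin] at this
    · refine squeeze_zero (fun k => by positivity) (fun k => ?_) hto
      refine le_trans ?_ (hvτ (n k))
      have h1 := hv1 (n k)
      have h0 : 0 < ‖v (n k)‖ := by linarith
      have hαk := hα (n k)
      have h2 : ‖v (n k)‖ * (‖v (n k)‖ ^ (1 - 1 / α (n k)) / ‖v (n k)‖) ^ σ =
          ‖v (n k)‖ ^ (1 - σ / α (n k)) := by
        have h3 : ‖v (n k)‖ ^ (1 - 1 / α (n k)) / ‖v (n k)‖ = ‖v (n k)‖ ^ (-(1 / α (n k))) := by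
          rw [← Real.rpow_sub_one h0.ne']
          congr 1
          ring
        rw [h3, ← Real.rpow_mul h0.le, sub_eq_add_neg, Real.rpow_add h0, Real.rpow_one]
        congr 2
        ring
      rw [h2]
      refine Real.rpow_le_rpow_of_exponent_le h1 ?_
      have h4 : τ (n k) ≤ σ := hk₀ _ ((Nat.le_add_left _ _).trans (hnk k))
      have : τ (n k) / α (n k) ≤ σ / α (n k) := by gcongr
      linarith

end Construction

/-! ### Choice of parameters and the theorem -/

section Main

variable {d : ℕ}

/-- The construction for a countable set of lines, in terms of its parameters. -/
theorem exists_largeWithSmallInjectiveProjections (hd : 1 ≤ d) {L : Set (EuclLine d)}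
    (hL : L.Countable) {t : ℝ} (ht : 0 ≤ t) {s α τ : ℕ → ℝ}
    (hs : ∀ m, 0 ≤ s m) (hα : ∀ n, 0 < α n) (hα1 : ∀ n, α n < 1) (hτ : ∀ n, α n < τ n)
    (hsα : ∀ m n, m ≤ n → s m < d - 1 + α n) (hst : Tendsto s atTop (𝓝 ((d : ℝ) - 1 + t)))
    (hτt : ∀ σ > t, ∀ᶠ n in atTop, τ n ≤ σ) :
    ∃ (Γ : Set (EuclideanSpace ℝ (Fin d))) (μ : Measure (EuclideanSpace ℝ (Fin d))),
      LargeWithSmallInjectiveProjections L t Γ ∧ IsProbabilityMeasure μ ∧ μ Γᶜ = 0 ∧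
      (∀ m, rieszEnergy (s m) μ < ⊤) ∧
      ∀ ℓ ∈ L, ∀ σ, (∀ᶠ n in atTop, τ n ≤ σ) →
        Measure.hausdorffMeasure σ (ℓ.proj '' Γ) = 0 := by
  have hdR : (1 : ℝ) ≤ d := by exact_mod_cast hd
  obtain ⟨ℓ₀⟩ := EuclLine.nonempty_of_pos hd
  -- `L` may be empty, but the upper bound for `dimH Γ` needs at least one line.
  have : Countable (insert ℓ₀ L : Set (EuclLine d)) := (hL.insert ℓ₀).to_subtype
  have : Nonempty (insert ℓ₀ L : Set (EuclLine d)) := ⟨⟨ℓ₀, mem_insert _ _⟩⟩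
  choose e ι he hι hproj using fun ℓ : (insert ℓ₀ L : Set (EuclLine d)) =>
    ℓ.1.exists_unit_isometry
  obtain ⟨Γ, μ, hΓ, hcube, hμ, hμΓ, hE, hinj, hnull⟩ :=
    exists_isCompact_small_inner_image hd he hs hα hα1 hτ hsα
  have himg : ∀ ℓ, (ℓ.1.proj '' Γ) = ι ℓ '' ((fun x => ⟪x, e ℓ⟫) '' Γ) := fun ℓ => by
    rw [image_image]
    exact image_congr fun x _ => hproj ℓ x
  have hupper : ∀ ℓ, dimH ((fun x => ⟪x, e ℓ⟫) '' Γ) ≤ ENNReal.ofReal t := by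
    intro ℓ
    have h1 : ∀ n : ℕ, dimH ((fun x => ⟪x, e ℓ⟫) '' Γ) ≤
        ENNReal.ofReal (t + 1 / ((n : ℝ) + 1)) := by
      intro n
      have hn : 0 < 1 / ((n : ℝ) + 1) := by positivity
      refine dimH_le_of_hausdorffMeasure_ne_top (d := (t + 1 / ((n : ℝ) + 1)).toNNReal) ?_
      rw [Real.coe_toNNReal _ (by linarith), hnull ℓ _ (hτt _ (by linarith))]
      exact ENNReal.zero_ne_top
    have hlim : Tendsto (fun n : ℕ => ENNReal.ofReal (t + 1 / ((n : ℝ) + 1))) atTop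
        (𝓝 (ENNReal.ofReal (t + 0))) :=
      ENNReal.tendsto_ofReal (tendsto_one_div_add_atTop_nhds_zero_nat.const_add t)
    rw [add_zero] at hlim
    exact ge_of_tendsto' hlim h1
  have hlow : ENNReal.ofReal ((d : ℝ) - 1 + t) ≤ dimH Γ :=
    le_of_tendsto' (ENNReal.tendsto_ofReal hst) fun m =>
      ofReal_le_dimH_of_rieszEnergy_lt_top (hE m) hΓ.isClosed hμΓ
  have hdim : dimH Γ = ENNReal.ofReal ((d : ℝ) - 1 + t) :=
    le_antisymm (dimH_le_dimH_inner_image_add hd (he ⟨ℓ₀, mem_insert _ _⟩) hΓ.isBounded ht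
      (hupper _)) hlow
  -- A projection of dimension below `t` would force `dimH Γ < d - 1 + t`.
  have hlower : ∀ ℓ, ENNReal.ofReal t ≤ dimH ((fun x => ⟪x, e ℓ⟫) '' Γ) := by
    intro ℓ
    by_contra! h
    have hfin := ne_top_of_lt h
    have h1 := dimH_le_dimH_inner_image_add hd (he ℓ) hΓ.isBounded
      (ENNReal.toReal_nonneg (a := dimH ((fun x => ⟪x, e ℓ⟫) '' Γ)))
      (ENNReal.ofReal_toReal hfin).ge
    rw [hdim, ENNReal.ofReal_le_ofReal_iff (by positivity)] at h1
    have h2 : t ≤ (dimH ((fun x => ⟪x, e ℓ⟫) '' Γ)).toReal := by linarith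
    rw [← ENNReal.ofReal_toReal hfin, ENNReal.ofReal_lt_ofReal_iff_of_nonneg
      ENNReal.toReal_nonneg] at h
    linarith
  refine ⟨Γ, μ, ⟨hΓ, hcube, hdim, fun ℓ hℓ x hx y hy hxy => ?_, fun ℓ hℓ => ?_⟩, hμ, hμΓ, hE,
    fun ℓ hℓ σ hσ => ?_⟩
  · let ℓ' : (insert ℓ₀ L : Set (EuclLine d)) := ⟨ℓ, mem_insert_of_mem _ hℓ⟩
    rw [show ℓ.proj x = _ from hproj ℓ' x, show ℓ.proj y = _ from hproj ℓ' y] at hxy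
    exact hinj ℓ' hx hy ((hι ℓ').injective hxy)
  · rw [himg ⟨ℓ, mem_insert_of_mem _ hℓ⟩, (hι _).dimH_image]
    exact le_antisymm (hupper _) (hlower _)
  · obtain ⟨n, hn⟩ := hσ.exists
    rw [himg ⟨ℓ, mem_insert_of_mem _ hℓ⟩,
      (hι _).hausdorffMeasure_image (Or.inl (by linarith [hτ n, hα n]))]
    exact hnull _ σ hσ

lemma tendsto_one_div_natCast_add_two : Tendsto (fun n : ℕ => 1 / ((n : ℝ) + 2)) atTop (𝓝 0) := by
  have h := (tendsto_one_div_add_atTop_nhds_zero_nat (𝕜 := ℝ)).comp (tendsto_add_atTop_nat 1)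
  refine h.congr fun n => ?_
  simp only [Function.comp_apply]
  push_cast
  ring_nf

/-- Positive capacity and infinite Hausdorff measure can be attained if the critical exponent is
positive. -/
lemma exists_capacity_pos (hd : 1 ≤ d) {L : Set (EuclLine d)} (hL : L.Countable) {t : ℝ}
    (ht : 0 ≤ t) (ht1 : t < 1) (hdt : 0 < (d : ℝ) - 1 + t) :
    ∃ Γ : Set (EuclideanSpace ℝ (Fin d)), LargeWithSmallInjectiveProjections L t Γ ∧
      0 < rieszCapacity ((d : ℝ) - 1 + t) Γ ∧
      Measure.hausdorffMeasure ((d : ℝ) - 1 + t) Γ = ⊤ := by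
  have hu : ∀ n : ℕ, 0 < 1 / ((n : ℝ) + 2) := fun n => by positivity
  have hu2 : ∀ n : ℕ, 1 / ((n : ℝ) + 2) ≤ 1 / 2 := fun n =>
    one_div_le_one_div_of_le (by norm_num) (by linarith [(n.cast_nonneg : (0 : ℝ) ≤ n)])
  have h1t : 0 < 1 - t := by linarith
  obtain ⟨Γ, μ, hΓ, hμ, hμΓ, hE, -⟩ := exists_largeWithSmallInjectiveProjections hd hL ht
    -- `α n` decreases to `t` from above, so the critical exponent itself is admissible at every
    -- stage; `n + 2` keeps `α n < 1`.
    (s := fun _ => (d : ℝ) - 1 + t) (α := fun n => t + (1 - t) * (1 / ((n : ℝ) + 2)))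
    (τ := fun n => t + 2 * (1 - t) * (1 / ((n : ℝ) + 2))) (fun _ => hdt.le)
    (fun n => by have := mul_pos h1t (hu n); linarith)
    (fun n => by nlinarith [hu2 n]) (fun n => by nlinarith [mul_pos h1t (hu n)])
    (fun m n _ => by linarith [mul_pos h1t (hu n)]) tendsto_const_nhds
    (fun σ hσ => by
      have h := (tendsto_one_div_natCast_add_two.const_mul (2 * (1 - t))).const_add t
      rw [mul_zero, add_zero] at h
      exact h.eventually_le_const hσ)
  exact ⟨Γ, hΓ, rieszCapacity_pos_of_rieszEnergy_lt_top (hE 0) hΓ.isCompact hμΓ,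
    hausdorffMeasure_eq_top_of_rieszEnergy_lt_top hdt (hE 0) hΓ.isCompact.isClosed hμΓ⟩

/-- Null projections can be attained if their dimension is positive. -/
lemma exists_projections_null (hd : 1 ≤ d) {L : Set (EuclLine d)} (hL : L.Countable) {t : ℝ}
    (ht : 0 < t) (ht1 : t ≤ 1) :
    ∃ Γ : Set (EuclideanSpace ℝ (Fin d)), LargeWithSmallInjectiveProjections L t Γ ∧
      ∀ ℓ ∈ L, Measure.hausdorffMeasure t (ℓ.proj '' Γ) = 0 := by
  have hdR : (1 : ℝ) ≤ d := by exact_mod_cast hd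
  have hu : ∀ n : ℕ, 0 < 1 / ((n : ℝ) + 2) := fun n => by positivity
  have hu2 : ∀ n : ℕ, 1 / ((n : ℝ) + 2) ≤ 1 / 2 := fun n =>
    one_div_le_one_div_of_le (by norm_num) (by linarith [(n.cast_nonneg : (0 : ℝ) ≤ n)])
  obtain ⟨Γ, μ, hΓ, -, -, -, hnull⟩ := exists_largeWithSmallInjectiveProjections hd hL ht.le
    -- `α n` increases to `t` from below, so the constant `τ = t` is admissible; the offset `n + 2`
    -- against `m + 1` makes `s m < d - 1 + α n` strict for `m ≤ n`.
    (s := fun m => (d : ℝ) - 1 + t * (1 - 1 / ((m : ℝ) + 1)))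
    (α := fun n => t * (1 - 1 / ((n : ℝ) + 2))) (τ := fun _ => t)
    (fun m => by
      have : 1 / ((m : ℝ) + 1) ≤ 1 := by
        rw [div_le_one (by positivity)]
        linarith [(m.cast_nonneg : (0 : ℝ) ≤ m)]
      nlinarith)
    (fun n => by nlinarith [hu2 n]) (fun n => by nlinarith [hu n]) (fun n => by nlinarith [hu n])
    (fun m n hmn => by
      have : 1 / ((n : ℝ) + 2) < 1 / ((m : ℝ) + 1) := by
        have h : (m : ℝ) ≤ n := by exact_mod_cast hmn
        exact one_div_lt_one_div_of_lt (by positivity) (by linarith)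
      nlinarith)
    (by
      have h := (((tendsto_one_div_add_atTop_nhds_zero_nat (𝕜 := ℝ)).const_sub 1).const_mul
        t).const_add ((d : ℝ) - 1)
      simpa using h)
    (fun σ hσ => Eventually.of_forall fun _ => le_of_lt hσ)
  exact ⟨Γ, hΓ, fun ℓ hℓ => hnull ℓ hℓ t (Eventually.of_forall fun _ => le_rfl)⟩

/-- On the real line, for dimension zero, a convergent sequence has all the properties. -/
lemma exists_capacity_pos_of_dim_one (L : Set (EuclLine 1)) :
    ∃ Γ : Set (EuclideanSpace ℝ (Fin 1)), LargeWithSmallInjectiveProjections L 0 Γ ∧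
      0 < rieszCapacity 0 Γ ∧ Measure.hausdorffMeasure 0 Γ = ⊤ := by
  let p : ℝ → EuclideanSpace ℝ (Fin 1) := fun u => WithLp.toLp 2 fun _ => u
  have hp : Continuous p := by fun_prop
  have hpinj : Function.Injective p := fun u u' h => by
    simpa [p] using congrArg (fun x : EuclideanSpace ℝ (Fin 1) => x 0) h
  let q : ℕ → EuclideanSpace ℝ (Fin 1) := fun n => p (1 / ((n : ℝ) + 1))
  have hq : Tendsto q atTop (𝓝 (p 0)) :=
    (hp.tendsto 0).comp tendsto_one_div_add_atTop_nhds_zero_nat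
  have hqinj : Function.Injective q := fun m n h => by
    have := hpinj h
    simpa using this
  set Γ := insert (p 0) (range q)
  have hcomp : IsCompact Γ := hq.isCompact_insert_range
  have hcount : Γ.Countable := (countable_range q).insert _
  -- In dimension one every line is the whole space.
  have hprojid : ∀ (ℓ : EuclLine 1) (x), ℓ.proj x = x := by
    intro ℓ x
    have htop : ℓ.1.direction = ⊤ := Submodule.eq_top_of_finrank_eq (by rw [ℓ.2.2]; simp)
    unfold EuclLine.proj
    rw [EuclideanGeometry.coe_orthogonalProjection_eq_iff_mem, vsub_self]
    refine ⟨?_, Submodule.zero_mem _⟩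
    rw [(AffineSubspace.direction_eq_top_iff_of_nonempty ℓ.2.1).1 htop]
    exact AffineSubspace.mem_top _ _ _
  refine ⟨Γ, ⟨hcomp, ?_, ?_, fun ℓ _ => ?_, fun ℓ _ => ?_⟩, ?_, ?_⟩
  · rintro x (rfl | ⟨n, rfl⟩) i
    · simp [p]
    · refine ⟨?_, ?_⟩
      · simp only [q, p]
        positivity
      · simp only [q, p]
        rw [div_le_one (by positivity)]
        linarith [(n.cast_nonneg : (0 : ℝ) ≤ n)]
  · rw [hcount.dimH_zero]
    simp
  · intro x _ y _ h
    simpa only [hprojid] using h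
  · rw [(hcount.image _).dimH_zero]
    simp
  · refine rieszCapacity_pos_of_rieszEnergy_lt_top (μ := Measure.dirac (p 0)) ?_ hcomp ?_
    · simp [rieszEnergy]
    · rw [Measure.dirac_apply' _ hcomp.isClosed.measurableSet.compl]
      simp [Γ]
  · rw [eq_top_iff]
    calc (⊤ : ℝ≥0∞) = ∑' n, Measure.hausdorffMeasure 0 {q n} := by
          simp only [Measure.hausdorffMeasure_zero_singleton]
          exact (ENNReal.tsum_const_eq_top_of_ne_zero one_ne_zero).symm
      _ = Measure.hausdorffMeasure 0 (⋃ n, {q n}) := by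
          rw [measure_iUnion]
          · exact fun m n hmn => disjoint_singleton.2 (hqinj.ne hmn)
          · exact fun n => measurableSet_singleton _
      _ ≤ Measure.hausdorffMeasure 0 Γ := by
          refine measure_mono (iUnion_subset fun n => ?_)
          exact singleton_subset_iff.2 (mem_insert_of_mem _ (mem_range_self n))

end Main

theorem theorem1 (d : ℕ) (hd : 1 ≤ d) (L : Set (EuclLine d)) (hL : L.Countable)
    (t : ℝ) (ht : t ∈ Set.Icc (0 : ℝ) 1) :
    (∃ Γ : Set (EuclideanSpace ℝ (Fin d)), LargeWithSmallInjectiveProjections L t Γ) ∧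
    (t < 1 → ∃ Γ : Set (EuclideanSpace ℝ (Fin d)),
      LargeWithSmallInjectiveProjections L t Γ ∧
      0 < rieszCapacity ((d : ℝ) - 1 + t) Γ ∧
      MeasureTheory.Measure.hausdorffMeasure ((d : ℝ) - 1 + t) Γ = ⊤) ∧
    (0 < t → ∃ Γ : Set (EuclideanSpace ℝ (Fin d)),
      LargeWithSmallInjectiveProjections L t Γ ∧
      ∀ ℓ ∈ L, MeasureTheory.Measure.hausdorffMeasure t (ℓ.proj '' Γ) = 0) := by
  have hdR : (1 : ℝ) ≤ d := by exact_mod_cast hd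
  have h1 : t < 1 → ∃ Γ : Set (EuclideanSpace ℝ (Fin d)),
      LargeWithSmallInjectiveProjections L t Γ ∧ 0 < rieszCapacity ((d : ℝ) - 1 + t) Γ ∧
      MeasureTheory.Measure.hausdorffMeasure ((d : ℝ) - 1 + t) Γ = ⊤ := by
    intro ht1
    rcases (show 0 ≤ (d : ℝ) - 1 + t by linarith [ht.1]).eq_or_lt with h | h
    -- Exponent zero needs its own example: every probability measure has finite `0`-energy, so this
    -- does not force `Γ` to be infinite.
    · have htz : t = 0 := by linarith [ht.1]
      have hd1 : d = 1 := by
        have : (d : ℝ) = 1 := by linarith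
        exact_mod_cast this
      subst hd1 htz
      simpa using exists_capacity_pos_of_dim_one L
    · exact exists_capacity_pos hd hL ht.1 ht1 h
  have h2 := fun h : 0 < t => exists_projections_null hd hL h ht.2
  refine ⟨?_, h1, h2⟩
  rcases ht.1.eq_or_lt with h | h
  · obtain ⟨Γ, hΓ, -⟩ := h1 (by linarith)
    exact ⟨Γ, hΓ⟩
  · obtain ⟨Γ, hΓ, -⟩ := h2 h
    exact ⟨Γ, hΓ⟩

end
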